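/- Let $L\ge 1$ and let $\mathcal H_L=\ell^2(\{0,\dots,L-1\})\otimes\mathbb C^2$ be the Hilbert space of the open chain with two internal degrees of freedom $A,B$ per site; let $C$ be the chiral operator, equal to $+1$ on $A$ and $-1$ on $B$. Let $H$ be a Hermitian $2L\times 2L$ matrix on $\mathcal H_L$ with $HC+CH=0$, and suppose that $H=\iota^*H^{\mathrm{bulk}}\iota$ for a bounded self-adjoint operator $H^{\mathrm{bulk}}$ on $\ell^2(\mathbb Z)\otimes\mathbb C^2$, where $\iota$ is the canonical inclusion of $\mathcal H_L$. Assume that there are constants $d,K_d,\Delta>0$ such that, $H^{\mathrm{bulk}}_{x,x'}$ denoting the $2\times2$ blocks of $H^{\mathrm{bulk}}$ and $\|\cdot\|$ the operator norm, $$\sup_{x\in\mathbb Z}\sum_{x'\in\mathbb Z}\|H^{\mathrm{bulk}}_{x,x'}\|\,e^{|x-x'|/d}\le K_d\qquad\text{and}\qquad \mathrm{Spec}(H^{\mathrm{bulk}})\cap(-\Delta,\Delta)=\emptyset .$$ Let $\theta:\{0,\dots,L-1\}\to\mathbb R$ be the step function that jumps from $1$ to $0$ in the middle of the chain, that is, $\theta(x)=1$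 for $x<m$ and $\theta(x)=0$ for $x\ge m$, where $m$ is an integer with $|2m-L|\le1$, and let $\theta(X)$ be the corresponding multiplication operator on $\mathcal H_L$. Put $$\delta=\sqrt{\frac{128\,\Delta\, d\,K_d}{L}},\qquad S=\tanh(H/\delta),\qquad \mathcal I_{\mathrm{bulk}}=\tfrac12\mathrm{Tr}\big(C\,S\,[\theta(X),S]\big),\qquad \mathcal I_{\mathrm{edge}}=\mathrm{Tr}\big(C\,\theta(X)\,(1-S^2)\big).$$ Then there is an integer $n$ such that $$|\mathcal I_{\mathrm{bulk}}-n|\le\gamma\, e^{-\sqrt{L\Delta/(128\,d\,K_d)}}\qquad\text{and}\qquad |\mathcal I_{\mathrm{edge}}-n|\le\gamma\, e^{-\sqrt{L\Delta/(128\,d\,K_d)}},$$ where $\gamma=P(K_d,d,L)$ and $P$ is a universal real polynomial in three variables, independent of $H$, $H^{\mathrm{bulk}}$, $\theta$, $L$, $d$, $K_d$ and $\Delta$. -/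

import Mathlib

noncomputable section

namespace ChiralChain

/-- Square matrices acting on the Hilbert space of the open chain with sites `0, …, L - 1` and two
internal degrees of freedom per site; `0 : Fin 2` stands for `A` and `1 : Fin 2` stands for `B`. -/
abbrev ChainMatrix (L : ℕ) : Type := Matrix (Fin L × Fin 2) (Fin L × Fin 2) ℂ

/-- The Hilbert space of the infinite chain, `ℓ²(ℤ) ⊗ ℂ² = ℓ²(ℤ × {A, B})`. -/
abbrev BulkSpace : Type := lp (fun _ : ℤ × Fin 2 => ℂ) 2

/-- The canonical basis vector `|x, s⟩` of the infinite chain. -/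
def bulkKet (x : ℤ) (s : Fin 2) : BulkSpace := lp.single 2 (x, s) (1 : ℂ)

/-- The block `T_{x,x'}` of an operator `T` on the infinite chain: the `2 × 2` matrix with
entries `⟨x, s| T |x', s'⟩`. -/
def block (T : BulkSpace →L[ℂ] BulkSpace) (x x' : ℤ) : Matrix (Fin 2) (Fin 2) ℂ :=
  Matrix.of fun s s' => inner ℂ (bulkKet x s) (T (bulkKet x' s'))

/-- The operator norm of a `2 × 2` matrix acting on the Hermitian space `ℂ²`. -/
def blockNorm (M : Matrix (Fin 2) (Fin 2) ℂ) : ℝ :=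
  ‖Matrix.toEuclideanCLM (n := Fin 2) (𝕜 := ℂ) M‖

/-- `sup_x ∑_{x'} ‖T_{x,x'}‖ exp (|x - x'| / d) ≤ K`, the sums being finite. -/
def IsShortRange (T : BulkSpace →L[ℂ] BulkSpace) (d K : ℝ) : Prop :=
  ∀ x : ℤ,
    Summable (fun x' : ℤ => blockNorm (block T x x') * Real.exp (|(x : ℝ) - (x' : ℝ)| / d)) ∧
    ∑' x' : ℤ, blockNorm (block T x x') * Real.exp (|(x : ℝ) - (x' : ℝ)| / d) ≤ K

/-- The spectrum of `T` does not meet the open real interval `(-Δ, Δ)`. -/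
def HasSpectralGap (T : BulkSpace →L[ℂ] BulkSpace) (Δ : ℝ) : Prop :=
  ∀ E : ℝ, E ∈ Set.Ioo (-Δ) Δ → (E : ℂ) ∉ spectrum ℂ T

/-- The truncation `ι* T ι` of `T` to the open chain, as a matrix in the canonical basis. -/
def truncation (L : ℕ) (T : BulkSpace →L[ℂ] BulkSpace) : ChainMatrix L :=
  Matrix.of fun i j => block T ((i.1 : ℕ) : ℤ) ((j.1 : ℕ) : ℤ) i.2 j.2

/-- The chiral operator: `1` on `A` and `-1` on `B`. -/
def chiralOp (L : ℕ) : ChainMatrix L :=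
  Matrix.diagonal fun i => if i.2 = 0 then 1 else -1

/-- `H` anticommutes with the chiral operator. -/
def IsChiral {L : ℕ} (H : ChainMatrix L) : Prop :=
  H * chiralOp L + chiralOp L * H = 0

/-- `θ` is a step function that equals `1` on the left half of the chain and `0` on the right half.
For odd `L` the jump may be on either side of the central site. -/
def IsMiddleStep {L : ℕ} (θ : Fin L → ℝ) : Prop :=
  ∃ m : ℕ, (2 * m = L ∨ 2 * m + 1 = L ∨ 2 * m = L + 1) ∧
    ∀ x : Fin L, θ x = if (x : ℕ) < m then 1 else 0

/-- The multiplication operator `θ(X)`. -/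
def mulOp {L : ℕ} (θ : Fin L → ℝ) : ChainMatrix L :=
  Matrix.diagonal fun i => (θ i.1 : ℂ)

/-- The regularized sign `S = tanh (H / δ)`, through the functional calculus of Hermitian
matrices. -/
def regSign {L : ℕ} (H : ChainMatrix L) (δ : ℝ) : ChainMatrix L :=
  cfc (fun E : ℝ => Real.tanh (E / δ)) H

/-- The bulk index `(1/2) Tr (C S [θ(X), S])`. -/
def bulkIndex {L : ℕ} (H : ChainMatrix L) (θ : Fin L → ℝ) (δ : ℝ) : ℂ :=
  (1 / 2 : ℂ) * Matrix.trace (chiralOp L * regSign H δ *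
    (mulOp θ * regSign H δ - regSign H δ * mulOp θ))

/-- The edge index `Tr (C θ(X) (1 - S²))`. -/
def edgeIndex {L : ℕ} (H : ChainMatrix L) (θ : Fin L → ℝ) (δ : ℝ) : ℂ :=
  Matrix.trace (chiralOp L * mulOp θ * (1 - regSign H δ ^ 2))

end ChiralChain

end

noncomputable section

namespace ChiralChain

open Matrix

/-! ### The Hilbert–Schmidt norm -/

section HilbertSchmidt

variable {l m n : Type*} [Fintype l] [Fintype m] [Fintype n]

/-! Write E = Δ/δ = √(LΔ/(128 d K)), p = θ(X), J = [p, H].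

The two indices are equal: S anticommutes with C, p commutes with C and Tr(Cp) = 0, so cyclicity of
the trace suffices (`bulkIndex_eq_edgeIndex`). Since 1 − tanh² = sech², both equal Tr(C p Q) with Q
= sech²(H/δ).

Near-integrality (`exists_int_near_trace_inv_cosh_sq`): with F = tanh(H/δ) sech(H/δ), the matrix Γ =
C(1 − 2Q) − 2F is a Hermitian involution. Its compression N = pΓp + (1 − p)C satisfies −½ Tr N =
Tr(CpQ) and 1 − N² = X*X with X = (1 − p)Γp. Rounding the eigenvalues of N to ±1 gives an integer
within ½‖X‖² in Hilbert–Schmidt norm. As X = (1 − p)[Γ, p] and the divided differences of sech² and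
tanh·sech are dominated by sech, ‖X‖² is at most a constant times δ⁻²‖sech(H/δ) J‖².

It remains to see that J has little weight at low energy (`hsSq_inv_cosh_mul_commutator_le`). By
short range, J stays bounded after multiplication by a weight D growing exponentially away from the
cut. The bulk gap gives ‖HA‖² ≥ Δ²‖A‖² up to an error exponentially small in L times ‖DA‖², because
truncation only matters at the ends, where D is large. Hence each application of (1 + H²/Δ²)⁻¹
divides the squared norm by 3, up to that error, while by Combes–Thomas it multiplies the squared
weighted norm by at most 16 (`hsSq_lowPass_le`). About 2E applications yield e^{-E} in the first
term, and the boundary error e^{-32E²} absorbs the growth in the second. Finally sech² is dominated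
by 4e^{-E} plus a multiple of the squared filter (`inv_cosh_sq_le_add`). -/

/-- The square of the Hilbert–Schmidt norm of a matrix. -/
def hsSq (A : Matrix m n ℂ) : ℝ := ∑ i, ∑ j, ‖A i j‖ ^ 2

theorem hsSq_nonneg (A : Matrix m n ℂ) : 0 ≤ hsSq A := by unfold hsSq; positivity

theorem trace_conjTranspose_mul_self (A : Matrix m n ℂ) :
    (Aᴴ * A).trace = (hsSq A : ℂ) := by
  simp only [trace, diag, mul_apply, conjTranspose_apply, hsSq, Complex.ofReal_sum]
  rw [Finset.sum_comm]
  refine Finset.sum_congr rfl fun i _ => Finset.sum_congr rfl fun j _ => ?_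
  have := RCLike.conj_mul (K := ℂ) (A i j)
  simpa using this

theorem hsSq_conjTranspose (A : Matrix m n ℂ) : hsSq Aᴴ = hsSq A := by
  simp only [hsSq, conjTranspose_apply, norm_star]
  exact Finset.sum_comm

theorem hsSq_neg (A : Matrix m n ℂ) : hsSq (-A) = hsSq A := by
  simp [hsSq]

theorem hsSq_smul (c : ℂ) (A : Matrix m n ℂ) : hsSq (c • A) = ‖c‖ ^ 2 * hsSq A := by
  simp only [hsSq, Finset.mul_sum, Matrix.smul_apply, smul_eq_mul, norm_mul, mul_pow]

theorem hsSq_add_le (A B : Matrix m n ℂ) : hsSq (A + B) ≤ 2 * hsSq A + 2 * hsSq B := by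
  simp only [hsSq, Finset.mul_sum, ← Finset.sum_add_distrib]
  refine Finset.sum_le_sum fun i _ => Finset.sum_le_sum fun j _ => ?_
  have h := norm_add_le (A i j) (B i j)
  have h0 := norm_nonneg (A i j + B i j)
  rw [Matrix.add_apply]
  nlinarith [sq_nonneg (‖A i j‖ - ‖B i j‖)]

theorem hsSq_mul_of_isometry [DecidableEq m] {U : Matrix l m ℂ} (hU : Uᴴ * U = 1)
    (A : Matrix m n ℂ) : hsSq (U * A) = hsSq A := by
  have h := trace_conjTranspose_mul_self (U * A)
  rw [conjTranspose_mul, Matrix.mul_assoc, ← Matrix.mul_assoc Uᴴ, hU, Matrix.one_mul,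
    trace_conjTranspose_mul_self] at h
  exact_mod_cast h.symm

theorem hsSq_mul_of_coisometry [DecidableEq m] {U : Matrix m l ℂ} (hU : U * Uᴴ = 1)
    (A : Matrix n m ℂ) : hsSq (A * U) = hsSq A := by
  rw [← hsSq_conjTranspose (A * U), conjTranspose_mul, hsSq_mul_of_isometry (by simpa using hU),
    hsSq_conjTranspose]

/-- The Schur test. -/
theorem sum_norm_sum_sq_le (V : m → n → ℝ) (hV : ∀ i j, 0 ≤ V i j) {R S : ℝ}
    (hR : ∀ i, ∑ j, V i j ≤ R) (hS : ∀ j, ∑ i, V i j ≤ S) (hR0 : 0 ≤ R) (x : n → ℝ) :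
    ∑ i, (∑ j, V i j * x j) ^ 2 ≤ R * S * ∑ j, x j ^ 2 := by
  calc ∑ i, (∑ j, V i j * x j) ^ 2
      ≤ ∑ i, (∑ j, V i j) * ∑ j, V i j * x j ^ 2 := by
        refine Finset.sum_le_sum fun i _ => ?_
        refine Finset.sum_sq_le_sum_mul_sum_of_sq_le_mul _ (fun j _ => hV i j)
          (fun j _ => mul_nonneg (hV i j) (sq_nonneg _)) fun j _ => le_of_eq (by ring)
    _ ≤ ∑ i, R * ∑ j, V i j * x j ^ 2 := by
        refine Finset.sum_le_sum fun i _ => mul_le_mul_of_nonneg_right (hR i) ?_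
        exact Finset.sum_nonneg fun j _ => mul_nonneg (hV i j) (sq_nonneg _)
    _ = R * ∑ j, (∑ i, V i j) * x j ^ 2 := by
        rw [← Finset.mul_sum, Finset.sum_comm]
        simp only [Finset.sum_mul]
    _ ≤ R * ∑ j, S * x j ^ 2 := by
        refine mul_le_mul_of_nonneg_left (Finset.sum_le_sum fun j _ => ?_) hR0
        exact mul_le_mul_of_nonneg_right (hS j) (sq_nonneg _)
    _ = R * S * ∑ j, x j ^ 2 := by rw [← Finset.mul_sum, mul_assoc]

theorem hsSq_mul_le_of_row_col {R : ℝ} (hR0 : 0 ≤ R) (V : Matrix l m ℂ)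
    (hR : ∀ i, ∑ j, ‖V i j‖ ≤ R) (hS : ∀ j, ∑ i, ‖V i j‖ ≤ R) (A : Matrix m n ℂ) :
    hsSq (V * A) ≤ R ^ 2 * hsSq A := by
  rw [← hsSq_conjTranspose A, ← hsSq_conjTranspose (V * A)]
  simp only [hsSq, conjTranspose_apply, norm_star]
  rw [Finset.mul_sum]
  refine Finset.sum_le_sum fun k _ => ?_
  refine le_trans ?_ (le_of_le_of_eq (sum_norm_sum_sq_le (fun i j => ‖V i j‖)
    (fun _ _ => norm_nonneg _) hR hS hR0 (fun j => ‖A j k‖)) (by rw [sq]))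
  refine Finset.sum_le_sum fun i _ => ?_
  gcongr
  rw [mul_apply]
  exact (norm_sum_le _ _).trans (le_of_eq (by simp))

end HilbertSchmidt

/-! ### Functions of a diagonalized matrix -/

section FunctionalCalculus

variable {n : Type*} [Fintype n] [DecidableEq n]

/-- The matrix `U f(e) U*`. -/
def fnMat (U : Matrix n n ℂ) (e : n → ℝ) (f : ℝ → ℝ) : Matrix n n ℂ :=
  U * diagonal (fun i => (f (e i) : ℂ)) * Uᴴ

theorem exists_diagonalization {H : Matrix n n ℂ} (hH : H.IsHermitian) :
    ∃ (U : Matrix n n ℂ) (e : n → ℝ), Uᴴ * U = 1 ∧ U * Uᴴ = 1 ∧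
      H = fnMat U e id ∧ ∀ f : ℝ → ℝ, cfc f H = fnMat U e f := by
  refine ⟨hH.eigenvectorUnitary, hH.eigenvalues, ?_, ?_, ?_, fun f => ?_⟩
  · exact Unitary.coe_star_mul_self hH.eigenvectorUnitary
  · exact Unitary.coe_mul_star_self hH.eigenvectorUnitary
  · conv_lhs => rw [hH.spectral_theorem]
    rfl
  · rw [hH.cfc_eq]
    rfl

variable {U : Matrix n n ℂ} {e : n → ℝ}

theorem fnMat_conjTranspose (f : ℝ → ℝ) : (fnMat U e f)ᴴ = fnMat U e f := by
  simp only [fnMat, conjTranspose_mul, conjTranspose_conjTranspose, diagonal_conjTranspose,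
    Matrix.mul_assoc]
  congr 3
  ext i
  simp

theorem fnMat_mul (hU : Uᴴ * U = 1) (f g : ℝ → ℝ) :
    fnMat U e f * fnMat U e g = fnMat U e fun x => f x * g x := by
  simp only [fnMat, Matrix.mul_assoc]
  rw [← Matrix.mul_assoc Uᴴ U, hU, Matrix.one_mul, ← Matrix.mul_assoc (diagonal _) (diagonal _),
    diagonal_mul_diagonal]
  simp

theorem fnMat_add (f g : ℝ → ℝ) :
    fnMat U e f + fnMat U e g = fnMat U e fun x => f x + g x := by
  simp only [fnMat, ← Matrix.add_mul, ← Matrix.mul_add, diagonal_add, Complex.ofReal_add]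

theorem fnMat_smul (c : ℝ) (f : ℝ → ℝ) :
    (c : ℂ) • fnMat U e f = fnMat U e fun x => c * f x := by
  rw [fnMat, ← Matrix.smul_mul, ← Matrix.mul_smul, ← diagonal_smul, fnMat]
  congr 3
  ext i
  simp

theorem fnMat_one (hU' : U * Uᴴ = 1) : fnMat U e (fun _ => 1) = 1 := by
  simp [fnMat, hU']

theorem conjTranspose_mul_fnMat (hU : Uᴴ * U = 1) (f : ℝ → ℝ) :
    Uᴴ * fnMat U e f = diagonal (fun i => (f (e i) : ℂ)) * Uᴴ := by
  rw [fnMat, Matrix.mul_assoc, ← Matrix.mul_assoc, hU, Matrix.one_mul]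

theorem fnMat_mul_self (hU : Uᴴ * U = 1) (f : ℝ → ℝ) :
    fnMat U e f * U = U * diagonal (fun i => (f (e i) : ℂ)) := by
  rw [fnMat, Matrix.mul_assoc, hU, Matrix.mul_one]

theorem hsSq_fnMat_mul (hU : Uᴴ * U = 1) (hU' : U * Uᴴ = 1) (f : ℝ → ℝ) (A : Matrix n n ℂ) :
    hsSq (fnMat U e f * A) = ∑ i, ∑ j, f (e i) ^ 2 * ‖(Uᴴ * A) i j‖ ^ 2 := by
  rw [← hsSq_mul_of_isometry (U := Uᴴ) (by simpa using hU'), ← Matrix.mul_assoc,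
    conjTranspose_mul_fnMat hU, Matrix.mul_assoc, hsSq]
  simp [diagonal_mul, mul_pow]

/-- The matrix elements in the eigenbasis of the commutator with a function of `H`. -/
theorem commutator_eigenbasis (hU : Uᴴ * U = 1) (f : ℝ → ℝ) (X : Matrix n n ℂ) (i j : n) :
    (Uᴴ * (X * fnMat U e f - fnMat U e f * X) * U) i j
      = (Uᴴ * X * U) i j * ((f (e j) : ℂ) - f (e i)) := by
  have : Uᴴ * (X * fnMat U e f - fnMat U e f * X) * U
      = (Uᴴ * X * U) * diagonal (fun i => (f (e i) : ℂ))
        - diagonal (fun i => (f (e i) : ℂ)) * (Uᴴ * X * U) := by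
    rw [Matrix.mul_sub, Matrix.sub_mul, ← Matrix.mul_assoc Uᴴ (fnMat U e f),
      conjTranspose_mul_fnMat hU, Matrix.mul_assoc Uᴴ (X * _), Matrix.mul_assoc X,
      fnMat_mul_self hU]
    simp only [Matrix.mul_assoc]
  rw [this, Matrix.sub_apply, mul_diagonal, diagonal_mul]
  ring

theorem hsSq_eigenbasis (hU' : U * Uᴴ = 1) (A : Matrix n n ℂ) :
    hsSq (Uᴴ * A * U) = hsSq A := by
  rw [hsSq_mul_of_coisometry hU', hsSq_mul_of_isometry (by simpa using hU')]

/-- If the divided differences of `f` are controlled by `g`, then so is the commutator of `f(H)`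
with a hermitian matrix, in Hilbert–Schmidt norm. -/
theorem hsSq_commutator_le (hU : Uᴴ * U = 1) (hU' : U * Uᴴ = 1) {f g : ℝ → ℝ} {c : ℝ}
    (hfg : ∀ x y, |f x - f y| ≤ c * |x - y| * (|g x| + |g y|)) {X : Matrix n n ℂ}
    (hX : Xᴴ = X) :
    hsSq (X * fnMat U e f - fnMat U e f * X)
      ≤ 4 * c ^ 2 * hsSq (fnMat U e g * (X * fnMat U e id - fnMat U e id * X)) := by
  set J := X * fnMat U e id - fnMat U e id * X with hJ
  have hJs : Jᴴ = -J := by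
    rw [hJ, conjTranspose_sub, conjTranspose_mul, conjTranspose_mul, fnMat_conjTranspose, hX]
    abel
  set Y := Uᴴ * J * U with hY
  -- J is anti-Hermitian because X is Hermitian. So weighting |Y i j|² by g at the row or at the
  -- column eigenvalue gives the same sum, and both halves of |g x| + |g y| are controlled by g(H)J.
  have hYs : ∀ i j, ‖Y i j‖ = ‖Y j i‖ := by
    intro i j
    have : Yᴴ = -Y := by
      rw [hY, conjTranspose_mul, conjTranspose_mul, conjTranspose_conjTranspose, hJs]
      simp [Matrix.mul_assoc]
    have h2 := congrFun (congrFun this j) i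
    rw [conjTranspose_apply, Matrix.neg_apply] at h2
    rw [← norm_star, h2, norm_neg]
  have hg : hsSq (fnMat U e g * J) = ∑ i, ∑ j, g (e i) ^ 2 * ‖Y i j‖ ^ 2 := by
    rw [← hsSq_mul_of_coisometry hU', Matrix.mul_assoc, hsSq_fnMat_mul hU hU', hY]
    simp only [Matrix.mul_assoc]
  have hg' : hsSq (fnMat U e g * J) = ∑ i, ∑ j, g (e j) ^ 2 * ‖Y i j‖ ^ 2 := by
    rw [hg, Finset.sum_comm]
    simp only [fun i j => hYs j i]
  calc hsSq (X * fnMat U e f - fnMat U e f * X)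
      = ∑ i, ∑ j, ‖(Uᴴ * X * U) i j * ((f (e j) : ℂ) - f (e i))‖ ^ 2 := by
        rw [← hsSq_eigenbasis hU', hsSq]
        simp only [commutator_eigenbasis hU]
    _ ≤ ∑ i, ∑ j, 2 * c ^ 2 * (g (e i) ^ 2 * ‖Y i j‖ ^ 2 + g (e j) ^ 2 * ‖Y i j‖ ^ 2) := by
        refine Finset.sum_le_sum fun i _ => Finset.sum_le_sum fun j _ => ?_
        have hYij : ‖Y i j‖ = ‖(Uᴴ * X * U) i j‖ * |e j - e i| := by
          rw [hY, hJ, commutator_eigenbasis hU, norm_mul, id, id, ← Complex.ofReal_sub,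
            Complex.norm_real, Real.norm_eq_abs]
        rw [norm_mul, ← Complex.ofReal_sub, Complex.norm_real, Real.norm_eq_abs, hYij]
        set a := ‖(Uᴴ * X * U) i j‖
        have h1 : (a * |f (e j) - f (e i)|) ^ 2
            ≤ (a * (c * |e j - e i| * (|g (e j)| + |g (e i)|))) ^ 2 := by
          have := hfg (e j) (e i)
          have ha : 0 ≤ a := norm_nonneg _
          gcongr
        refine h1.trans ?_
        rw [← sq_abs (g (e i)), ← sq_abs (g (e j))]
        nlinarith [mul_nonneg (sq_nonneg (a * (c * |e j - e i|)))
          (sq_nonneg (|g (e j)| - |g (e i)|))]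
    _ = 4 * c ^ 2 * hsSq (fnMat U e g * J) := by
        have h4 : 4 * c ^ 2 * hsSq (fnMat U e g * J)
            = 2 * c ^ 2 * (hsSq (fnMat U e g * J) + hsSq (fnMat U e g * J)) := by ring
        rw [h4]
        nth_rewrite 1 [hg]
        rw [hg', ← Finset.sum_add_distrib, Finset.mul_sum]
        refine Finset.sum_congr rfl fun i _ => ?_
        rw [← Finset.sum_add_distrib, Finset.mul_sum]

/-- In the eigenbasis, anticommutation reads (e i + e j) X i j = 0, so X only links opposite
eigenvalues, where the parity of f (s = 1 even, s = -1 odd) compares the two values. -/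
theorem fnMat_commute_of_even (hU : Uᴴ * U = 1) (hU' : U * Uᴴ = 1) {X : Matrix n n ℂ}
    (hX : fnMat U e id * X + X * fnMat U e id = 0) {f : ℝ → ℝ} {s : ℝ}
    (hf : ∀ x, f (-x) = s * f x) : fnMat U e f * X = (s : ℂ) • (X * fnMat U e f) := by
  have key : ∀ (g : ℝ → ℝ), Uᴴ * (fnMat U e g * X) * U
      = diagonal (fun i => (g (e i) : ℂ)) * (Uᴴ * X * U) := by
    intro g
    rw [← Matrix.mul_assoc Uᴴ, conjTranspose_mul_fnMat hU]
    simp only [Matrix.mul_assoc]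
  have key' : ∀ (g : ℝ → ℝ), Uᴴ * (X * fnMat U e g) * U
      = (Uᴴ * X * U) * diagonal (fun i => (g (e i) : ℂ)) := by
    intro g
    simp only [Matrix.mul_assoc, fnMat_mul_self hU]
  have inj : ∀ A B : Matrix n n ℂ, Uᴴ * A * U = Uᴴ * B * U → A = B := by
    intro A B h
    have h2 : U * (Uᴴ * A * U) * Uᴴ = U * (Uᴴ * B * U) * Uᴴ := by rw [h]
    simpa only [Matrix.mul_assoc, hU', Matrix.mul_one, ← Matrix.mul_assoc U Uᴴ, Matrix.one_mul]
      using h2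
  apply inj
  rw [Matrix.mul_smul, Matrix.smul_mul, key, key']
  ext i j
  have h0 : (Uᴴ * (fnMat U e id * X + X * fnMat U e id) * U) i j = 0 := by rw [hX]; simp
  rw [Matrix.mul_add, Matrix.add_mul, key, key', Matrix.add_apply, diagonal_mul, mul_diagonal] at h0
  rw [Matrix.smul_apply, diagonal_mul, mul_diagonal, smul_eq_mul]
  have h1 : (Uᴴ * X * U) i j * (((e i + e j : ℝ)) : ℂ) = 0 := by
    rw [← h0]; push_cast; simp only [id]; ring
  rcases mul_eq_zero.1 h1 with h | h
  · rw [h]; ring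
  · have h3 : e j = - e i := by
      have := Complex.ofReal_eq_zero.1 h
      linarith
    have h4 : f (e i) = s * f (e j) := by
      rw [← hf, h3, neg_neg]
    rw [h4]; push_cast; ring

end FunctionalCalculus

/-! ### Hyperbolic secant estimates -/

section Hyperbolic

/-- Mean value inequality: |sinh z| ≤ cosh z, and on the segment cosh z is at most the larger
endpoint value. The bound is relative rather than absolute, so after inversion the differences of
sech keep a factor of sech. -/
theorem abs_cosh_sub_cosh_le (x y : ℝ) :
    |Real.cosh y - Real.cosh x| ≤ |x - y| * (Real.cosh x + Real.cosh y) := by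
  have h := Convex.norm_image_sub_le_of_norm_hasDerivWithin_le (𝕜 := ℝ) (f := Real.cosh)
    (f' := Real.sinh) (s := Set.uIcc x y) (x := x) (y := y) (C := Real.cosh x + Real.cosh y)
    (fun z _ => (Real.hasDerivAt_cosh z).hasDerivWithinAt) ?_ (convex_uIcc x y)
    Set.left_mem_uIcc Set.right_mem_uIcc
  · rw [Real.norm_eq_abs, Real.norm_eq_abs, abs_sub_comm y x] at h
    linarith
  · intro z hz
    have h1 : |Real.sinh z| ≤ Real.cosh z := by
      rw [Real.abs_sinh, ← Real.cosh_abs]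
      exact (Real.sinh_lt_cosh _).le
    have h2 : |z| ≤ |x| ∨ |z| ≤ |y| := le_max_iff.1 (by
      rcases Set.mem_uIcc.1 hz with h | h
      · exact abs_le_max_abs_abs h.1 h.2
      · rw [max_comm]; exact abs_le_max_abs_abs h.1 h.2)
    have hx := Real.cosh_pos x
    have hy := Real.cosh_pos y
    rw [Real.norm_eq_abs]
    rcases h2 with h2 | h2
    · have := Real.cosh_le_cosh.2 h2; linarith
    · have := Real.cosh_le_cosh.2 h2; linarith

theorem tanh_sq_add_inv_cosh_sq (x : ℝ) : Real.tanh x ^ 2 + (Real.cosh x)⁻¹ ^ 2 = 1 := by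
  have h := (Real.cosh_pos x).ne'
  rw [Real.tanh_eq_sinh_div_cosh]
  field_simp
  rw [Real.cosh_sq]

theorem abs_tanh_le_one (x : ℝ) : |Real.tanh x| ≤ 1 := by
  rw [← sq_le_one_iff_abs_le_one]
  nlinarith [tanh_sq_add_inv_cosh_sq x, sq_nonneg (Real.cosh x)⁻¹]

theorem inv_cosh_le_one (x : ℝ) : (Real.cosh x)⁻¹ ≤ 1 := inv_le_one_of_one_le₀ (Real.one_le_cosh x)

theorem abs_tanh_sub_tanh_le (x y : ℝ) : |Real.tanh x - Real.tanh y| ≤ |x - y| := by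
  have h := Convex.norm_image_sub_le_of_norm_hasDerivWithin_le (𝕜 := ℝ) (f := Real.tanh)
    (f' := fun z => (Real.cosh z)⁻¹ ^ 2) (s := Set.univ) (x := y) (y := x) (C := 1)
    (fun z _ => ?_) (fun z _ => ?_) convex_univ trivial trivial
  · simpa using h
  · have h1 := (Real.hasDerivAt_sinh z).div (Real.hasDerivAt_cosh z) (Real.cosh_pos z).ne'
    have h2 : Real.tanh = Real.sinh / Real.cosh := by
      ext t; exact Real.tanh_eq_sinh_div_cosh t
    rw [h2]
    refine (h1.congr_deriv ?_).hasDerivWithinAt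
    have := (Real.cosh_pos z).ne'
    field_simp
    nlinarith [Real.cosh_sq z]
  · rw [Real.norm_eq_abs, abs_of_nonneg (by positivity)]
    have := Real.cosh_pos z
    exact pow_le_one₀ (by positivity) (inv_cosh_le_one z)

/-- This and the next two estimates feed `hsSq_commutator_le` with g = sech. The surviving sech is
what restricts the commutators to low energies. -/
theorem abs_inv_cosh_sub_inv_cosh_le (x y : ℝ) :
    |(Real.cosh x)⁻¹ - (Real.cosh y)⁻¹| ≤ |x - y| * ((Real.cosh x)⁻¹ + (Real.cosh y)⁻¹) := by
  have hx := Real.cosh_pos x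
  have hy := Real.cosh_pos y
  have h1 : (Real.cosh x)⁻¹ - (Real.cosh y)⁻¹
      = (Real.cosh y - Real.cosh x) * ((Real.cosh x)⁻¹ * (Real.cosh y)⁻¹) := by
    field_simp
  have h2 : |x - y| * ((Real.cosh x)⁻¹ + (Real.cosh y)⁻¹)
      = |x - y| * (Real.cosh x + Real.cosh y) * ((Real.cosh x)⁻¹ * (Real.cosh y)⁻¹) := by
    field_simp
    ring
  rw [h1, h2, abs_mul, abs_of_nonneg (by positivity : 0 ≤ (Real.cosh x)⁻¹ * (Real.cosh y)⁻¹)]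
  exact mul_le_mul_of_nonneg_right (abs_cosh_sub_cosh_le x y) (by positivity)

theorem abs_inv_cosh_sq_sub_le (x y : ℝ) :
    |(Real.cosh x)⁻¹ ^ 2 - (Real.cosh y)⁻¹ ^ 2|
      ≤ 2 * |x - y| * ((Real.cosh x)⁻¹ + (Real.cosh y)⁻¹) := by
  have hx := inv_pos.2 (Real.cosh_pos x)
  have hy := inv_pos.2 (Real.cosh_pos y)
  have hx1 := inv_cosh_le_one x
  have hy1 := inv_cosh_le_one y
  rw [sq_sub_sq, abs_mul, abs_of_pos (by positivity : 0 < (Real.cosh x)⁻¹ + (Real.cosh y)⁻¹)]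
  have h1 := abs_inv_cosh_sub_inv_cosh_le x y
  have h0 := abs_nonneg (x - y)
  nlinarith [mul_nonneg h0 (add_nonneg hx.le hy.le)]

theorem abs_tanh_mul_inv_cosh_sub_le (x y : ℝ) :
    |Real.tanh x * (Real.cosh x)⁻¹ - Real.tanh y * (Real.cosh y)⁻¹|
      ≤ 2 * |x - y| * ((Real.cosh x)⁻¹ + (Real.cosh y)⁻¹) := by
  have hx := inv_pos.2 (Real.cosh_pos x)
  have hy := inv_pos.2 (Real.cosh_pos y)
  have h1 : Real.tanh x * (Real.cosh x)⁻¹ - Real.tanh y * (Real.cosh y)⁻¹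
      = (Real.tanh x - Real.tanh y) * (Real.cosh x)⁻¹
        + Real.tanh y * ((Real.cosh x)⁻¹ - (Real.cosh y)⁻¹) := by ring
  rw [h1]
  refine (abs_add_le _ _).trans ?_
  rw [abs_mul, abs_mul, abs_of_pos hx]
  have h2 := mul_le_mul_of_nonneg_right (abs_tanh_sub_tanh_le x y) hx.le
  have h3 := mul_le_mul (abs_tanh_le_one y) (abs_inv_cosh_sub_inv_cosh_le x y) (abs_nonneg _)
    zero_le_one
  nlinarith [mul_nonneg (abs_nonneg (x - y)) hy.le]

theorem inv_cosh_sq_le (x : ℝ) : (Real.cosh x)⁻¹ ^ 2 ≤ 4 * Real.exp (-(2 * |x|)) := by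
  have h1 : Real.exp |x| / 2 ≤ Real.cosh x := by
    rw [← Real.cosh_abs, Real.cosh_eq]
    linarith [Real.exp_pos (-|x|)]
  have h2 : (Real.cosh x)⁻¹ ≤ 2 * Real.exp (-|x|) := by
    rw [Real.exp_neg, inv_le_comm₀ (Real.cosh_pos x) (by positivity), mul_inv, inv_inv]
    linarith
  calc (Real.cosh x)⁻¹ ^ 2 ≤ (2 * Real.exp (-|x|)) ^ 2 := by
        have := Real.cosh_pos x
        gcongr
    _ = 4 * Real.exp (-(2 * |x|)) := by
        rw [mul_pow, ← Real.exp_nat_mul]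
        congr 1
        · norm_num
        · congr 1; push_cast; ring

end Hyperbolic

/-! ### Near-symmetries have nearly integral traces -/

section Integrality

variable {n : Type*} [Fintype n] [DecidableEq n]

theorem trace_fnMat {U : Matrix n n ℂ} (hU : Uᴴ * U = 1) (e : n → ℝ) (f : ℝ → ℝ) :
    (fnMat U e f).trace = ∑ i, (f (e i) : ℂ) := by
  rw [fnMat, Matrix.mul_assoc, trace_mul_comm, Matrix.mul_assoc, hU, Matrix.mul_one,
    trace_diagonal]

/-- Positivity of X*X forces every eigenvalue of N into [-1, 1], where its distance to the nearest
sign is at most 1 - e². There are 2L signs, so minus half their sum is an integer. The second bound,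
by L, serves the regime where the exponential is not small. -/
theorem exists_int_near_half_trace {L : ℕ} (hcard : Fintype.card n = 2 * L) {N X : Matrix n n ℂ}
    (hN : N.IsHermitian) (hX : 1 - N * N = Xᴴ * X) :
    ∃ k : ℤ, ‖-(1 / 2 : ℂ) * N.trace - k‖ ≤ 1 / 2 * hsSq X ∧
      ‖-(1 / 2 : ℂ) * N.trace - k‖ ≤ L := by
  obtain ⟨U, e, hU, hU', hNU, -⟩ := exists_diagonalization hN
  have h1 : Xᴴ * X = fnMat U e fun x => 1 + (-1) * (x * x) := by
    rw [← hX, ← fnMat_add (fun _ => 1), fnMat_one hU', ← fnMat_smul (-1)]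
    have : fnMat U e (fun x => x * x) = N * N := by
      rw [hNU, fnMat_mul hU]; rfl
    rw [this]
    push_cast
    rw [neg_one_smul, sub_eq_add_neg]
  have h2 : hsSq X = ∑ i, (1 - e i ^ 2) := by
    have h := trace_conjTranspose_mul_self X
    rw [h1, trace_fnMat hU, ← Complex.ofReal_sum, Complex.ofReal_inj] at h
    rw [← h]
    exact Finset.sum_congr rfl fun i _ => by ring
  have h3 : ∀ i, 0 ≤ 1 - e i ^ 2 := by
    intro i
    have hm : (X * U)ᴴ * (X * U) = diagonal fun i => ((1 + (-1) * (e i * e i) : ℝ) : ℂ) := by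
      calc (X * U)ᴴ * (X * U) = Uᴴ * (Xᴴ * X) * U := by
            simp only [conjTranspose_mul, Matrix.mul_assoc]
        _ = _ := by
            rw [h1, conjTranspose_mul_fnMat hU, Matrix.mul_assoc, hU, Matrix.mul_one]
    have h := congrFun (congrFun hm i) i
    rw [diagonal_apply_eq] at h
    have h4 : ((X * U)ᴴ * (X * U)) i i = ((∑ j, ‖(X * U) j i‖ ^ 2 : ℝ) : ℂ) := by
      rw [mul_apply, Complex.ofReal_sum]
      refine Finset.sum_congr rfl fun j _ => ?_
      have := RCLike.conj_mul (K := ℂ) ((X * U) j i)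
      simpa using this
    rw [h4, Complex.ofReal_inj] at h
    have h5 : (0 : ℝ) ≤ ∑ j, ‖(X * U) j i‖ ^ 2 := by positivity
    linarith
  set σ : n → ℤ := fun i => if 0 ≤ e i then 0 else 1 with hσ
  have h4 : ∀ i, |e i - (1 - 2 * (σ i : ℝ))| ≤ 1 - e i ^ 2 := by
    intro i
    have := h3 i
    have ha : |e i| ≤ 1 := by rw [← sq_le_one_iff_abs_le_one]; linarith
    rw [abs_le] at ha
    by_cases h : 0 ≤ e i
    · simp only [hσ, h, if_true]
      rw [abs_le]; push_cast; constructor <;> nlinarith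
    · simp only [hσ, h, if_false]
      rw [abs_le]; push_cast; constructor <;> nlinarith
  have h5 : ‖-(1 / 2 : ℂ) * N.trace - ((∑ i, σ i - L : ℤ) : ℂ)‖ ≤ 1 / 2 * ∑ i, (1 - e i ^ 2) := by
    have h6 : N.trace = ((∑ i, e i : ℝ) : ℂ) := by
      rw [hNU, trace_fnMat hU]; simp
    have h7 : -(1 / 2 : ℂ) * N.trace - ((∑ i, σ i - L : ℤ) : ℂ)
        = ((-(1 / 2) * ∑ i, (e i - (1 - 2 * (σ i : ℝ))) : ℝ) : ℂ) := by
      rw [h6, Finset.sum_sub_distrib, Finset.sum_sub_distrib, ← Finset.mul_sum]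
      simp only [Finset.sum_const, Finset.card_univ, hcard]
      push_cast
      simp
      ring
    rw [h7, Complex.norm_real, Real.norm_eq_abs, abs_mul]
    have h8 : |(-(1 / 2) : ℝ)| = 1 / 2 := by norm_num
    rw [h8]
    gcongr
    exact (Finset.abs_sum_le_sum_abs _ _).trans (Finset.sum_le_sum fun i _ => h4 i)
  refine ⟨∑ i, σ i - L, h5.trans_eq (by rw [h2]), h5.trans ?_⟩
  calc 1 / 2 * ∑ i, (1 - e i ^ 2) ≤ 1 / 2 * ∑ _i : n, (1 : ℝ) := by
        gcongr with i
        linarith [sq_nonneg (e i)]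
    _ = L := by simp [hcard]

/-- Pythagoras for the orthogonal projections p and 1 - p. -/
theorem hsSq_one_sub_mul_le {p : Matrix n n ℂ} (hp : pᴴ = p) (hp2 : p * p = p)
    (A : Matrix n n ℂ) : hsSq ((1 - p) * A) ≤ hsSq A := by
  have h1 := trace_conjTranspose_mul_self A
  have h2 := trace_conjTranspose_mul_self (p * A)
  have h3 := trace_conjTranspose_mul_self ((1 - p) * A)
  have h4 : Aᴴ * A = (p * A)ᴴ * (p * A) + ((1 - p) * A)ᴴ * ((1 - p) * A) := by
    rw [conjTranspose_mul, conjTranspose_mul, conjTranspose_sub, hp, conjTranspose_one]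
    have h5 : (1 - p) * (1 - p) = 1 - p := by
      rw [Matrix.mul_sub, Matrix.sub_mul, Matrix.sub_mul, hp2]; simp
    calc Aᴴ * A = Aᴴ * (p + (1 - p)) * A := by simp
      _ = Aᴴ * (p * p + (1 - p) * (1 - p)) * A := by rw [hp2, h5]
      _ = _ := by simp only [Matrix.mul_add, Matrix.add_mul, Matrix.mul_assoc]
  rw [h4, trace_add, h2, h3] at h1
  have h6 : hsSq (p * A) + hsSq ((1 - p) * A) = hsSq A := by exact_mod_cast h1
  linarith [hsSq_nonneg (p * A)]

end Integrality

/-! ### Integrality of the index of a chiral matrix -/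

section Index

variable {n : Type*} [Fintype n] [DecidableEq n] {U : Matrix n n ℂ} {e : n → ℝ}
  {C p : Matrix n n ℂ}

/-- Compressing the symmetry `C (1 - 2 sech² H) - 2 sech H tanh H` to the range of `p` yields a
near-symmetry whose trace is `-2 Tr (C p sech² H)`. -/
theorem exists_int_near_trace_inv_cosh_sq {L : ℕ} (hcard : Fintype.card n = 2 * L)
    (hU : Uᴴ * U = 1) (hU' : U * Uᴴ = 1) (hC : Cᴴ = C) (hC2 : C * C = 1) (hp : pᴴ = p)
    (hp2 : p * p = p) (hpC : p * C = C * p) (htr : (C * p).trace = 0) (htrC : C.trace = 0)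
    (hchi : fnMat U e id * C + C * fnMat U e id = 0) {δ : ℝ} (hδ : 0 < δ) :
    ∃ k : ℤ,
      ‖(C * p * fnMat U e fun x => (Real.cosh (x / δ))⁻¹ ^ 2).trace - k‖
          ≤ 128 / δ ^ 2 * hsSq (fnMat U e (fun x => (Real.cosh (x / δ))⁻¹) *
            (p * fnMat U e id - fnMat U e id * p)) ∧
      ‖(C * p * fnMat U e fun x => (Real.cosh (x / δ))⁻¹ ^ 2).trace - k‖ ≤ L := by
  set Q := fnMat U e fun x => (Real.cosh (x / δ))⁻¹ ^ 2 with hQ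
  set F := fnMat U e fun x => Real.tanh (x / δ) * (Real.cosh (x / δ))⁻¹ with hF
  have hQC : Q * C = C * Q := by
    have := fnMat_commute_of_even hU hU' hchi (f := fun x => (Real.cosh (x / δ))⁻¹ ^ 2) (s := 1)
      (fun x => by simp [neg_div])
    rwa [Complex.ofReal_one, one_smul] at this
  have hFC : F * C = -(C * F) := by
    have := fnMat_commute_of_even hU hU' hchi
      (f := fun x => Real.tanh (x / δ) * (Real.cosh (x / δ))⁻¹) (s := -1)
      (fun x => by simp [neg_div, Real.tanh_neg])
    simpa using this
  have hFF : F * F = Q - Q * Q := by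
    have h1 : Q - Q * Q = Q + ((-1 : ℝ) : ℂ) • (Q * Q) := by
      push_cast; rw [neg_one_smul, sub_eq_add_neg]
    rw [h1, hQ, hF, fnMat_mul hU, fnMat_mul hU, fnMat_smul, fnMat_add]
    congr 1
    funext x
    linear_combination (Real.cosh (x / δ))⁻¹ ^ 2 * tanh_sq_add_inv_cosh_sq (x / δ)
  have hQF : Q * F = F * Q := by
    rw [hQ, hF, fnMat_mul hU, fnMat_mul hU]
    simp only [mul_comm]
  have hQs : Qᴴ = Q := fnMat_conjTranspose _
  have hFs : Fᴴ = F := fnMat_conjTranspose _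
  -- C(1 - 2Q) anticommutes with F, and (1 - 2Q)² + 4F² = 1 since F² = Q - Q². Hence Γ is an
  -- involution.
  set Γ := C - (2 : ℂ) • (C * Q) - (2 : ℂ) • F with hΓ
  have hΓs : Γᴴ = Γ := by
    rw [hΓ]
    simp only [conjTranspose_sub, conjTranspose_smul, conjTranspose_mul, hC, hQs, hFs, hQC]
    simp
  have hCCQ : ∀ Z : Matrix n n ℂ, C * (C * Z) = Z := fun Z => by
    rw [← Matrix.mul_assoc, hC2, Matrix.one_mul]
  have hΓ2 : Γ * Γ = 1 := by
    have hQCQ : Q * (C * Q) = C * (Q * Q) := by rw [← Matrix.mul_assoc, hQC, Matrix.mul_assoc]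
    have hFCQ : F * (C * Q) = -(C * (F * Q)) := by
      rw [← Matrix.mul_assoc, hFC, Matrix.neg_mul, Matrix.mul_assoc]
    rw [hΓ]
    simp only [Matrix.mul_sub, Matrix.sub_mul, Matrix.mul_smul, Matrix.smul_mul, hC2, hQC, hFC,
      hFF, Matrix.mul_assoc, hCCQ, hQCQ, hFCQ, hQF]
    simp only [smul_sub, smul_neg, smul_smul]
    module
  -- Filling the complement of p with C makes the defect 1 - N² live on the range of p, where it is
  -- pΓ(1 - p)Γp. It adds no trace, as C and Cp are traceless.
  set N := p * Γ * p + (1 - p) * C with hN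
  have hNs : N.IsHermitian := by
    rw [IsHermitian, hN]
    simp only [conjTranspose_add, conjTranspose_mul, conjTranspose_sub, hp, hC, hΓs,
      Matrix.sub_mul, Matrix.one_mul, hpC, Matrix.mul_assoc]
  have hppZ : ∀ Z : Matrix n n ℂ, p * (p * Z) = p * Z := fun Z => by
    rw [← Matrix.mul_assoc, hp2]
  have hpCZ : ∀ Z : Matrix n n ℂ, p * (C * Z) = C * (p * Z) := fun Z => by
    rw [← Matrix.mul_assoc, hpC, Matrix.mul_assoc]
  have hΓΓZ : ∀ Z : Matrix n n ℂ, Γ * (Γ * Z) = Z := fun Z => by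
    rw [← Matrix.mul_assoc, hΓ2, Matrix.one_mul]
  have hX : 1 - N * N = ((1 - p) * Γ * p)ᴴ * ((1 - p) * Γ * p) := by
    rw [hN]
    simp only [conjTranspose_mul, conjTranspose_sub, hp, hΓs, Matrix.mul_sub,
      Matrix.sub_mul, Matrix.mul_add, Matrix.add_mul,
      Matrix.one_mul, hpC, Matrix.mul_assoc, hppZ, hpCZ, hp2, hCCQ, hC2, hΓΓZ]
    abel
  have hpF : (p * F).trace = 0 := by
    have h1 : (p * F).trace = -(p * F).trace := by
      calc (p * F).trace = (C * (C * (p * F))).trace := by rw [hCCQ]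
        _ = ((C * (p * F)) * C).trace := trace_mul_comm _ _
        _ = -(p * F).trace := by
            rw [Matrix.mul_assoc, Matrix.mul_assoc, hFC, Matrix.mul_neg, Matrix.mul_neg, trace_neg,
              hpCZ, hCCQ]
    exact self_eq_neg.1 h1
  have htrN : -(1 / 2 : ℂ) * N.trace = (C * p * Q).trace := by
    have h1 : (p * Γ * p).trace = (p * Γ).trace := by
      rw [trace_mul_comm, ← Matrix.mul_assoc, hp2]
    rw [hN, trace_add, h1, Matrix.sub_mul, Matrix.one_mul, trace_sub, htrC, hpC, htr, hΓ,
      Matrix.mul_sub, Matrix.mul_sub, Matrix.mul_smul, Matrix.mul_smul, trace_sub, trace_sub,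
      trace_smul, trace_smul, hpF, hpC, htr, ← Matrix.mul_assoc, hpC]
    simp
  obtain ⟨k, hk1, hk2⟩ := exists_int_near_half_trace hcard hNs hX
  rw [htrN] at hk1 hk2
  refine ⟨k, hk1.trans ?_, hk2⟩
  set J := p * fnMat U e id - fnMat U e id * p with hJ
  set R := fnMat U e (fun x => (Real.cosh (x / δ))⁻¹) with hR
  have hdiv : ∀ x y : ℝ, |x / δ - y / δ| = |x - y| / δ := by
    intro x y; rw [← sub_div, abs_div, abs_of_pos hδ]
  have habs : ∀ x : ℝ, |(Real.cosh (x / δ))⁻¹| = (Real.cosh (x / δ))⁻¹ :=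
    fun x => abs_of_pos (inv_pos.2 (Real.cosh_pos _))
  have hcQ : hsSq (p * Q - Q * p) ≤ 4 * (2 / δ) ^ 2 * hsSq (R * J) := by
    refine hsSq_commutator_le hU hU' (fun x y => ?_) hp
    have h := abs_inv_cosh_sq_sub_le (x / δ) (y / δ)
    rw [hdiv] at h
    rw [habs, habs]
    exact h.trans_eq (by ring)
  have hcF : hsSq (p * F - F * p) ≤ 4 * (2 / δ) ^ 2 * hsSq (R * J) := by
    refine hsSq_commutator_le hU hU' (fun x y => ?_) hp
    have h := abs_tanh_mul_inv_cosh_sub_le (x / δ) (y / δ)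
    rw [hdiv] at h
    rw [habs, habs]
    exact h.trans_eq (by ring)
  -- Since (1 - p)p = 0, Γp may be replaced by the commutator Γp - pΓ.
  have hXc : (1 - p) * Γ * p
      = (1 - p) * ((2 : ℂ) • (C * (p * Q - Q * p)) + (2 : ℂ) • (p * F - F * p)) := by
    have h1 : (2 : ℂ) • (C * (p * Q - Q * p)) + (2 : ℂ) • (p * F - F * p) = Γ * p - p * Γ := by
      rw [hΓ]
      simp only [Matrix.mul_sub, Matrix.sub_mul, Matrix.mul_smul, Matrix.smul_mul, hpC, hpCZ,
        Matrix.mul_assoc, smul_sub]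
      abel
    have h2 : (1 - p) * p = 0 := by rw [Matrix.sub_mul, Matrix.one_mul, hp2, sub_self]
    rw [h1, Matrix.mul_sub (1 - p) (Γ * p), ← Matrix.mul_assoc (1 - p) p, h2, Matrix.zero_mul,
      sub_zero, Matrix.mul_assoc]
  have h2 := (hsSq_one_sub_mul_le hp hp2
    ((2 : ℂ) • (C * (p * Q - Q * p)) + (2 : ℂ) • (p * F - F * p))).trans (hsSq_add_le _ _)
  rw [hsSq_smul, hsSq_smul, hsSq_mul_of_isometry (U := C) (by rw [hC, hC2])] at h2
  rw [hXc]
  have h4 : ‖(2 : ℂ)‖ = 2 := by simp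
  rw [h4] at h2
  calc _ ≤ 1 / 2 * (2 * (2 ^ 2 * (4 * (2 / δ) ^ 2 * hsSq (R * J)))
        + 2 * (2 ^ 2 * (4 * (2 / δ) ^ 2 * hsSq (R * J)))) := by linarith
    _ = 128 / δ ^ 2 * hsSq (R * J) := by
        field_simp
        ring

end Index

/-! ### The bulk operator -/

section Bulk

/-- T is invertible, and its self-adjoint inverse has norm equal to its spectral radius, which the
gap bounds by 1/Δ. -/
theorem mul_norm_le_of_hasSpectralGap {T : BulkSpace →L[ℂ] BulkSpace} (hT : IsSelfAdjoint T)
    {Δ : ℝ} (hΔ : 0 < Δ) (hgap : HasSpectralGap T Δ) (ψ : BulkSpace) : Δ * ‖ψ‖ ≤ ‖T ψ‖ := by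
  have h0 : (0 : ℂ) ∉ spectrum ℂ T := by
    have := hgap 0 ⟨by linarith, hΔ⟩
    simpa using this
  obtain ⟨u, rfl⟩ := spectrum.zero_notMem_iff ℂ |>.1 h0
  have hinv : IsSelfAdjoint ((u⁻¹ : (BulkSpace →L[ℂ] BulkSpace)ˣ) : BulkSpace →L[ℂ] BulkSpace) := by
    have h : star u = u := Units.ext hT
    rw [isSelfAdjoint_iff, ← Units.coe_star, star_inv, h]
  have hnorm : ‖((u⁻¹ : (BulkSpace →L[ℂ] BulkSpace)ˣ) : BulkSpace →L[ℂ] BulkSpace)‖ ≤ Δ⁻¹ := by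
    have hr := hinv.spectralRadius_eq_nnnorm
    have hle : spectralRadius ℂ ((u⁻¹ : (BulkSpace →L[ℂ] BulkSpace)ˣ) : BulkSpace →L[ℂ] BulkSpace)
        ≤ ENNReal.ofReal Δ⁻¹ := by
      refine iSup₂_le fun z hz => ?_
      have hz2 := hz
      rw [← spectrum.map_inv, Set.mem_inv] at hz2
      have hzr : z⁻¹ = ((z⁻¹).re : ℂ) := hT.mem_spectrum_eq_re hz2
      have hz0 : z⁻¹ ≠ 0 := fun h => h0 (h ▸ hz2)
      have hge : Δ ≤ ‖z⁻¹‖ := by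
        by_contra hlt
        rw [hzr, Complex.norm_real, Real.norm_eq_abs, not_le, abs_lt] at hlt
        exact hgap _ hlt (hzr ▸ hz2)
      rw [← ENNReal.ofReal_coe_nnreal]
      refine ENNReal.ofReal_le_ofReal ?_
      rw [norm_inv] at hge
      rw [coe_nnnorm]
      exact (le_inv_comm₀ hΔ (by
        rw [norm_pos_iff]; intro h; exact hz0 (by simp [h]))).1 hge
    rw [hr, ← ENNReal.ofReal_coe_nnreal] at hle
    exact (ENNReal.ofReal_le_ofReal_iff (by positivity)).1 hle
  have h1 : ((u⁻¹ : (BulkSpace →L[ℂ] BulkSpace)ˣ) : BulkSpace →L[ℂ] BulkSpace)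
      ((u : BulkSpace →L[ℂ] BulkSpace) ψ) = ψ := by
    rw [← mul_apply_eq_comp, Units.inv_mul]; rfl
  have h2 := ContinuousLinearMap.le_of_opNorm_le _ hnorm ((u : BulkSpace →L[ℂ] BulkSpace) ψ)
  rw [h1] at h2
  rwa [le_inv_mul_iff₀ hΔ] at h2

theorem norm_apply_le_blockNorm (M : Matrix (Fin 2) (Fin 2) ℂ) (s s' : Fin 2) :
    ‖M s s'‖ ≤ blockNorm M := by
  have h1 := (toEuclideanCLM (n := Fin 2) (𝕜 := ℂ) M).le_opNorm (EuclideanSpace.single s' 1)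
  have h2 := PiLp.norm_apply_le
    (toEuclideanCLM (n := Fin 2) (𝕜 := ℂ) M (EuclideanSpace.single s' 1)) s
  have h3 : (toEuclideanCLM (n := Fin 2) (𝕜 := ℂ) M (EuclideanSpace.single s' 1)) s = M s s' := by
    rw [EuclideanSpace.single, toEuclideanCLM_toLp]
    simp
  rw [h3] at h2
  simpa [blockNorm] using h2.trans h1

/-- The weighted absolute values of the matrix elements of `T`. -/
def weightedEntry (T : BulkSpace →L[ℂ] BulkSpace) (d : ℝ) (u v : ℤ × Fin 2) : ℝ :=
  ‖block T u.1 v.1 u.2 v.2‖ * Real.exp (|(u.1 : ℝ) - (v.1 : ℝ)| / d)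

variable {T : BulkSpace →L[ℂ] BulkSpace} {d K : ℝ}

theorem weightedEntry_nonneg (u v : ℤ × Fin 2) : 0 ≤ weightedEntry T d u v := by
  unfold weightedEntry; positivity

theorem weightedEntry_comm (hT : IsSelfAdjoint T) (u v : ℤ × Fin 2) :
    weightedEntry T d u v = weightedEntry T d v u := by
  have h : ‖block T u.1 v.1 u.2 v.2‖ = ‖block T v.1 u.1 v.2 u.2‖ := by
    simp only [block, of_apply]
    rw [← inner_conj_symm, RCLike.norm_conj]
    exact congrArg norm (hT.isSymmetric _ _)
  rw [weightedEntry, weightedEntry, h, abs_sub_comm]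

/-- The factor 2 counts the internal states of the target site, each entry being bounded by the
block norm. -/
theorem sum_weightedEntry_le (hs : IsShortRange T d K) (u : ℤ × Fin 2) (s : Finset (ℤ × Fin 2)) :
    ∑ v ∈ s, weightedEntry T d u v ≤ 2 * K := by
  classical
  obtain ⟨h1, h2⟩ := hs u.1
  calc ∑ v ∈ s, weightedEntry T d u v
      ≤ ∑ v ∈ s.image Prod.fst ×ˢ Finset.univ, weightedEntry T d u v := by
        refine Finset.sum_le_sum_of_subset_of_nonneg (fun v hv => ?_)
          fun v _ _ => weightedEntry_nonneg u v
        exact Finset.mem_product.2 ⟨Finset.mem_image_of_mem _ hv, Finset.mem_univ _⟩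
    _ = ∑ x ∈ s.image Prod.fst, ∑ t : Fin 2, weightedEntry T d u (x, t) :=
        Finset.sum_product _ _ _
    _ ≤ ∑ x ∈ s.image Prod.fst,
          2 * (blockNorm (block T u.1 x) * Real.exp (|(u.1 : ℝ) - (x : ℝ)| / d)) := by
        refine Finset.sum_le_sum fun x _ => ?_
        rw [Fin.sum_univ_two, two_mul]
        exact add_le_add
          (mul_le_mul_of_nonneg_right (norm_apply_le_blockNorm _ _ _) (Real.exp_pos _).le)
          (mul_le_mul_of_nonneg_right (norm_apply_le_blockNorm _ _ _) (Real.exp_pos _).le)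
    _ ≤ 2 * K := by
        rw [← Finset.mul_sum]
        refine mul_le_mul_of_nonneg_left ((h1.sum_le_tsum _ fun x _ => ?_).trans h2) zero_le_two
        exact mul_nonneg (norm_nonneg _) (Real.exp_pos _).le

theorem summable_weightedEntry (hs : IsShortRange T d K) (u : ℤ × Fin 2) :
    Summable (weightedEntry T d u) :=
  summable_of_sum_le (weightedEntry_nonneg u) (sum_weightedEntry_le hs u)

theorem tsum_weightedEntry_le (hs : IsShortRange T d K) (u : ℤ × Fin 2) :
    ∑' v, weightedEntry T d u v ≤ 2 * K :=
  (summable_weightedEntry hs u).tsum_le_of_sum_le (sum_weightedEntry_le hs u)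

/-- For distinct sites s = |x - y|/d ≥ 1/d, and e^{-s/2} ≤ e^{-1/(2d)} ≤ 2d. The point is the
prefactor d: later bounds then contain K only through dK, and dK/Δ is controlled by L when E ≥ 1,
whereas K/Δ is not when d is small. -/
theorem exp_mul_le_two_mul_exp (hd : 0 < d) {κ s : ℝ} (hκ : κ ≤ 1 / 2) (hs : 1 / d ≤ s) :
    Real.exp (κ * s) ≤ 2 * d * Real.exp s := by
  have h1 : Real.exp (κ * s - s) ≤ 2 * d := by
    have h2 : κ * s - s ≤ -(1 / (2 * d)) := by
      have h3 : 1 / (2 * d) = 1 / 2 * (1 / d) := by field_simp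
      have h4 : 0 < 1 / d := by positivity
      rw [h3]; nlinarith
    refine (Real.exp_le_exp.2 h2).trans ?_
    rw [Real.exp_neg, inv_le_comm₀ (Real.exp_pos _) (by positivity), ← one_div]
    linarith [Real.add_one_le_exp (1 / (2 * d))]
  calc Real.exp (κ * s) = Real.exp (κ * s - s) * Real.exp s := by rw [← Real.exp_add]; ring_nf
    _ ≤ _ := by gcongr

theorem hasSum_norm_sq (ψ : BulkSpace) : HasSum (fun u => ‖ψ u‖ ^ 2) (‖ψ‖ ^ 2) := by
  have h := lp.hasSum_norm (p := 2) (by norm_num) ψ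
  simpa using h

variable {L : ℕ}

/-- The inclusion of the sites of the open chain. -/
def site (v : Fin L × Fin 2) : ℤ × Fin 2 := (((v.1 : ℕ) : ℤ), v.2)

theorem site_injective : Function.Injective (site (L := L)) := by
  rintro ⟨x, s⟩ ⟨y, t⟩ h
  simp only [site, Prod.mk.injEq, Nat.cast_inj] at h
  exact Prod.ext (Fin.ext h.1) h.2

/-- The inclusion of the Hilbert space of the open chain. -/
def embed (φ : Fin L × Fin 2 → ℂ) : BulkSpace := ∑ v, φ v • lp.single 2 (site v) (1 : ℂ)

theorem norm_embed_sq (φ : Fin L × Fin 2 → ℂ) : ‖embed φ‖ ^ 2 = ∑ v, ‖φ v‖ ^ 2 := by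
  classical
  have happ : ∀ u, embed φ u = ∑ v, φ v * (Pi.single (site v) (1 : ℂ) : ℤ × Fin 2 → ℂ) u := by
    intro u
    have h : ∀ f : BulkSpace, f u = inner ℂ (lp.single 2 u (1 : ℂ) : BulkSpace) f := by
      intro f
      rw [lp.inner_single_left]
      simp
    rw [h, embed, inner_sum]
    refine Finset.sum_congr rfl fun v _ => ?_
    rw [inner_smul_right, ← h, lp.single_apply]
  have h1 : ∀ v, embed φ (site v) = φ v := by
    intro v
    rw [happ, Finset.sum_eq_single v]
    · simp
    · intro w _ hw
      rw [Pi.single_eq_of_ne (fun h => hw (site_injective h).symm), mul_zero]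
    · simp
  have h2 : ∀ u ∉ Finset.univ.image (site (L := L)), ‖embed φ u‖ ^ 2 = 0 := by
    intro u hu
    rw [happ, Finset.sum_eq_zero]
    · simp
    · intro w _
      rw [Pi.single_eq_of_ne (fun h => hu (by rw [h]; simp)), mul_zero]
  have h3 := (hasSum_norm_sq (embed φ)).unique (hasSum_sum_of_ne_finset_zero h2)
  rw [h3, Finset.sum_image site_injective.injOn]
  simp only [h1]

theorem apply_embed (φ : Fin L × Fin 2 → ℂ) (u : ℤ × Fin 2) :
    T (embed φ) u = ∑ v, block T u.1 (site v).1 u.2 (site v).2 * φ v := by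
  have h : ∀ f : BulkSpace, f u = inner ℂ (bulkKet u.1 u.2) f := by
    intro f
    rw [bulkKet, lp.inner_single_left]
    simp
  rw [h, embed, map_sum, inner_sum]
  refine Finset.sum_congr rfl fun v _ => ?_
  rw [map_smul, inner_smul_right, mul_comm]
  rfl

/-- The gap of the bulk operator survives on the open chain, up to an error living on the
boundary. -/
theorem gap_le_norm_mulVec_add_boundary (hT : IsSelfAdjoint T) {Δ : ℝ} (hΔ : 0 < Δ)
    (hgap : HasSpectralGap T Δ) (hd : 0 < d) (hK : 0 < K) (hs : IsShortRange T d K) {κ ℓ : ℝ}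
    (hκ0 : 0 ≤ κ) (hκ : κ ≤ 1 / 2) {w : ℤ → ℝ} (hw : ∀ x y : ℤ, w x - w y ≤ |(x : ℝ) - y|)
    (hℓ : ∀ x : ℤ, (x < 0 ∨ (L : ℤ) ≤ x) → ℓ ≤ w x) (φ : Fin L × Fin 2 → ℂ) :
    Δ ^ 2 * ∑ v, ‖φ v‖ ^ 2 ≤ ∑ v, ‖(truncation L T *ᵥ φ) v‖ ^ 2
      + (4 * d * K) ^ 2 * Real.exp (-(2 * κ * ℓ / d)) *
        ∑ v, (Real.exp (κ / d * w (site v).1) * ‖φ v‖) ^ 2 := by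
  classical
  set χ : Fin L × Fin 2 → ℝ := fun v => Real.exp (κ / d * w (site v).1) * ‖φ v‖ with hχ
  have hχ0 : ∀ v, 0 ≤ χ v := fun v => by positivity
  set A := Real.exp (-(κ * ℓ / d)) * (2 * d) with hA
  have hA0 : 0 ≤ A := by positivity
  set g : ℤ × Fin 2 → ℝ := fun u => ∑ v, weightedEntry T d u (site v) * χ v ^ 2 with hg
  have hg0 : ∀ u, 0 ≤ g u := fun u =>
    Finset.sum_nonneg fun v _ => mul_nonneg (weightedEntry_nonneg _ _) (sq_nonneg _)
  have hgs : HasSum g (∑ v, (∑' u, weightedEntry T d (site v) u) * χ v ^ 2) := by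
    refine hasSum_sum fun v _ => ?_
    simp only [fun u => weightedEntry_comm (d := d) hT u (site v)]
    exact (summable_weightedEntry hs (site v)).hasSum.mul_right _
  have hin : ∀ v, T (embed φ) (site v) = (truncation L T *ᵥ φ) v := by
    intro v
    rw [apply_embed]
    rfl
  -- Outside the chain w u ≥ ℓ, so the Lipschitz bound gives e^{-κ w(v)/d} ≤ e^{-κℓ/d} e^{κ|u-v|/d}.
  -- The last factor is paid for by the short-range weight, as κ ≤ 1/2.
  have hout : ∀ u ∉ Finset.univ.image (site (L := L)),
      ‖T (embed φ) u‖ ^ 2 ≤ A ^ 2 * (2 * K) * g u := by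
    intro u hu
    have hux : u.1 < 0 ∨ (L : ℤ) ≤ u.1 := by
      by_contra! hc
      refine hu (Finset.mem_image.2 ⟨(⟨u.1.toNat, by omega⟩, u.2), Finset.mem_univ _, ?_⟩)
      exact Prod.ext (by simp [site, hc.1]) rfl
    have hpt : ∀ v, ‖block T u.1 (site v).1 u.2 (site v).2‖ * ‖φ v‖
        ≤ A * (weightedEntry T d u (site v) * χ v) := by
      intro v
      set s := |(u.1 : ℝ) - ((site v).1 : ℝ)| / d with hsdef
      have hne : u.1 ≠ (site v).1 := by
        have h1 : (site v).1 = ((v.1 : ℕ) : ℤ) := rfl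
        have h2 := v.1.2
        omega
      have hs1 : 1 / d ≤ s := by
        rw [hsdef]
        have h1 : (1 : ℝ) ≤ |(u.1 : ℝ) - ((site v).1 : ℝ)| := by
          have h2 : 1 ≤ |u.1 - (site v).1| := Int.one_le_abs (sub_ne_zero.2 hne)
          exact_mod_cast h2
        gcongr
      have h1 : ‖φ v‖ = Real.exp (-(κ / d * w (site v).1)) * χ v := by
        rw [hχ]
        simp only
        rw [← mul_assoc, ← Real.exp_add]
        simp
      have h2 : Real.exp (-(κ / d * w (site v).1)) ≤ A * Real.exp s := by
        have h3 : -(κ / d * w (site v).1) ≤ -(κ * ℓ / d) + κ * s := by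
          have h4 := hw u.1 (site v).1
          have h5 := hℓ u.1 hux
          have h6 : 0 ≤ κ / d := by positivity
          have h7 : -(κ * ℓ / d) + κ * s
              = κ / d * (|(u.1 : ℝ) - ((site v).1 : ℝ)| - ℓ) := by
            rw [hsdef]; ring
          rw [h7, ← mul_neg]
          exact mul_le_mul_of_nonneg_left (by linarith) h6
        refine (Real.exp_le_exp.2 h3).trans ?_
        rw [Real.exp_add, hA, mul_assoc]
        exact mul_le_mul_of_nonneg_left (exp_mul_le_two_mul_exp hd hκ hs1) (Real.exp_pos _).le
      rw [h1, weightedEntry]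
      calc ‖block T u.1 (site v).1 u.2 (site v).2‖ * (Real.exp (-(κ / d * w (site v).1)) * χ v)
          ≤ ‖block T u.1 (site v).1 u.2 (site v).2‖ * (A * Real.exp s * χ v) := by
            have := hχ0 v
            gcongr
        _ = _ := by ring
    have h1 : ‖T (embed φ) u‖ ≤ A * ∑ v, weightedEntry T d u (site v) * χ v := by
      rw [apply_embed, Finset.mul_sum]
      refine (norm_sum_le _ _).trans (Finset.sum_le_sum fun v _ => ?_)
      rw [norm_mul]
      exact hpt v
    -- Cauchy–Schwarz with respect to the weights `weightedEntry`, the first half of a Schur test.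
    -- The sum over u is done afterwards through `hgs`.
    have h2 : (∑ v, weightedEntry T d u (site v) * χ v) ^ 2 ≤ 2 * K * g u := by
      refine (Finset.sum_sq_le_sum_mul_sum_of_sq_le_mul _
        (fun v _ => weightedEntry_nonneg u (site v))
        (fun v _ => mul_nonneg (weightedEntry_nonneg u (site v)) (sq_nonneg (χ v)))
        fun v _ => le_of_eq (by ring)).trans ?_
      refine mul_le_mul_of_nonneg_right ?_ (hg0 u)
      have := sum_weightedEntry_le hs u (Finset.univ.image (site (L := L)))
      rwa [Finset.sum_image site_injective.injOn] at this
    calc ‖T (embed φ) u‖ ^ 2 ≤ (A * ∑ v, weightedEntry T d u (site v) * χ v) ^ 2 := by gcongr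
      _ = A ^ 2 * (∑ v, weightedEntry T d u (site v) * χ v) ^ 2 := by ring
      _ ≤ A ^ 2 * (2 * K * g u) := by gcongr
      _ = A ^ 2 * (2 * K) * g u := by ring
  set I : ℤ × Fin 2 → ℝ := fun u =>
    if u ∈ Finset.univ.image (site (L := L)) then ‖T (embed φ) u‖ ^ 2 else 0 with hI
  have hIs : HasSum I (∑ v, ‖(truncation L T *ᵥ φ) v‖ ^ 2) := by
    have h1 : ∀ u ∉ Finset.univ.image (site (L := L)), I u = 0 :=
      fun u hu => by simp only [hI, hu, if_false]
    have h2 := hasSum_sum_of_ne_finset_zero (L := SummationFilter.unconditional _) h1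
    rw [Finset.sum_image site_injective.injOn] at h2
    convert h2 using 2 with v
    simp only [hI, hin]
    rw [if_pos (Finset.mem_image_of_mem _ (Finset.mem_univ v))]
  have hle : ‖T (embed φ)‖ ^ 2 ≤ ∑ v, ‖(truncation L T *ᵥ φ) v‖ ^ 2
      + A ^ 2 * (2 * K) * ∑ v, (∑' u, weightedEntry T d (site v) u) * χ v ^ 2 := by
    refine hasSum_le (fun u => ?_)
      (hasSum_norm_sq (T (embed φ))) (hIs.add (hgs.mul_left (A ^ 2 * (2 * K))))
    by_cases hu : u ∈ Finset.univ.image (site (L := L))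
    · simp only [hI, hu, if_true]
      have := mul_nonneg (by positivity : 0 ≤ A ^ 2 * (2 * K)) (hg0 u)
      linarith
    · simp only [hI, hu, if_false, zero_add]
      exact hout u hu
  have h1 := mul_norm_le_of_hasSpectralGap hT hΔ hgap (embed φ)
  have h2 : (Δ * ‖embed φ‖) ^ 2 ≤ ‖T (embed φ)‖ ^ 2 := by gcongr
  rw [mul_pow, norm_embed_sq] at h2
  refine (h2.trans hle).trans (add_le_add le_rfl ?_)
  calc A ^ 2 * (2 * K) * ∑ v, (∑' u, weightedEntry T d (site v) u) * χ v ^ 2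
      ≤ A ^ 2 * (2 * K) * ∑ v, (2 * K) * χ v ^ 2 := by
        gcongr with v
        exact tsum_weightedEntry_le hs _
    _ = (4 * d * K) ^ 2 * Real.exp (-(2 * κ * ℓ / d)) * ∑ v, χ v ^ 2 := by
        have h3 : Real.exp (-(2 * κ * ℓ / d)) = Real.exp (-(κ * ℓ / d)) ^ 2 := by
          rw [← Real.exp_nat_mul]; congr 1; push_cast; ring
        rw [← Finset.mul_sum, hA, h3]
        ring
/-- The gap cannot exceed the size of the operator. -/
theorem gap_le_two_mul (hT : IsSelfAdjoint T) {Δ : ℝ} (hΔ : 0 < Δ) (hgap : HasSpectralGap T Δ)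
    (hd : 0 < d) (hK : 0 < K) (hs : IsShortRange T d K) : Δ ≤ 2 * K := by
  have h1 := mul_norm_le_of_hasSpectralGap hT hΔ hgap (bulkKet 0 0)
  have h2 : ‖bulkKet 0 0‖ = 1 := by
    rw [bulkKet, lp.norm_single (by norm_num)]; simp
  rw [h2, mul_one] at h1
  -- The image of one basis vector is a column of T, whose ℓ² norm is at most its ℓ¹ norm.
  refine h1.trans (abs_le_of_sq_le_sq' ?_ (by positivity)).2
  refine hasSum_le_of_sum_le (hasSum_norm_sq (T (bulkKet 0 0))) fun s => ?_
  have h3 : ∀ u, ‖T (bulkKet 0 0) u‖ ≤ weightedEntry T d (0, 0) u := by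
    intro u
    rw [weightedEntry_comm hT, weightedEntry]
    have h : T (bulkKet 0 0) u = block T u.1 0 u.2 0 := by
      rw [block, of_apply, bulkKet.eq_def u.1 u.2, lp.inner_single_left]
      simp
    rw [h]
    exact le_mul_of_one_le_right (norm_nonneg _) (Real.one_le_exp (by positivity))
  have h4 := sum_weightedEntry_le hs (0, 0) s
  calc ∑ u ∈ s, ‖T (bulkKet 0 0) u‖ ^ 2 ≤ ∑ u ∈ s, weightedEntry T d (0, 0) u ^ 2 := by
        gcongr with u; exact h3 u
    _ ≤ (∑ u ∈ s, weightedEntry T d (0, 0) u) ^ 2 :=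
        Finset.sum_sq_le_sq_sum_of_nonneg fun u _ => weightedEntry_nonneg _ _
    _ ≤ (2 * K) ^ 2 := by
        have := Finset.sum_nonneg fun u (_ : u ∈ s) =>
          weightedEntry_nonneg (T := T) (d := d) (0, 0) u
        gcongr

end Bulk

/-! ### Weighted resolvent estimates -/

section Weighted

variable {n : Type*} [Fintype n] [DecidableEq n] {U : Matrix n n ℂ} {e : n → ℝ}

theorem hsSq_fnMat_mul_le (hU : Uᴴ * U = 1) (hU' : U * Uᴴ = 1) {f g h : ℝ → ℝ} {a b : ℝ}
    (hfg : ∀ x, f x ^ 2 ≤ a * g x ^ 2 + b * h x ^ 2) (A : Matrix n n ℂ) :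
    hsSq (fnMat U e f * A) ≤ a * hsSq (fnMat U e g * A) + b * hsSq (fnMat U e h * A) := by
  simp only [hsSq_fnMat_mul hU hU', Finset.mul_sum, ← Finset.sum_add_distrib]
  refine Finset.sum_le_sum fun i _ => Finset.sum_le_sum fun j _ => ?_
  nlinarith [mul_le_mul_of_nonneg_right (hfg (e i)) (sq_nonneg ‖(Uᴴ * A) i j‖)]

/-- Combes–Thomas estimate: if conjugation by the positive diagonal matrix `D` changes `H` by at
most `Δ / 2`, then `1 ± i H / Δ` is bounded below in the weighted Hilbert–Schmidt norm. -/
theorem hsSq_weighted_le_factor (hU : Uᴴ * U = 1) (hU' : U * Uᴴ = 1) {D : n → ℝ}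
    (hD : ∀ i, 0 < D i) {Δ : ℝ} (hΔ : 0 < Δ)
    (hrow : ∀ i, ∑ j, ‖fnMat U e id i j‖ * |D i * (D j)⁻¹ - 1| ≤ Δ / 2)
    (hcol : ∀ j, ∑ i, ‖fnMat U e id i j‖ * |D i * (D j)⁻¹ - 1| ≤ Δ / 2)
    {s : ℝ} (hs : s ^ 2 = 1) (A : Matrix n n ℂ) :
    hsSq (diagonal (fun i => (D i : ℂ)) * A) ≤
      4 * hsSq (diagonal (fun i => (D i : ℂ)) *
        (A + (Complex.I * (s / Δ : ℝ)) • (fnMat U e id * A))) := by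
  set H := fnMat U e id with hH
  set W := diagonal (fun i => (D i : ℂ)) with hW
  set W' := diagonal (fun i => ((D i)⁻¹ : ℂ)) with hW'
  have hWW : W' * W = 1 := by
    rw [hW, hW', diagonal_mul_diagonal, ← diagonal_one]
    congr 1
    ext i
    have : (D i : ℂ) ≠ 0 := by exact_mod_cast (hD i).ne'
    simp [this]
  set z : ℂ := Complex.I * (s / Δ : ℝ) with hz
  have hz2 : ‖z‖ ^ 2 = 1 / Δ ^ 2 := by
    rw [hz, norm_mul, Complex.norm_I, one_mul, Complex.norm_real, Real.norm_eq_abs, sq_abs, div_pow,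
      hs]
  set V := W * H * W' - H with hV
  have hVij : ∀ i j, ‖V i j‖ = ‖H i j‖ * |D i * (D j)⁻¹ - 1| := by
    intro i j
    have : V i j = H i j * ((D i * (D j)⁻¹ - 1 : ℝ) : ℂ) := by
      rw [hV, Matrix.sub_apply, hW', mul_diagonal, hW, diagonal_mul]
      push_cast
      ring
    rw [this, norm_mul, Complex.norm_real, Real.norm_eq_abs]
  set Ψ := W * A with hΨ
  -- V = W H W⁻¹ - H, so weighting turns 1 + zH into 1 + zH + zV. The first part does not decrease
  -- norms, z being imaginary and H Hermitian.
  have hX : W * (A + z • (H * A)) = (Ψ + z • (H * Ψ)) + z • (V * Ψ) := by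
    have h1 : W * H * A = H * Ψ + V * Ψ := by
      rw [← Matrix.add_mul, hV, add_sub_cancel, hΨ, ← Matrix.mul_assoc, Matrix.mul_assoc _ W',
        hWW, Matrix.mul_one]
    rw [Matrix.mul_add, Matrix.mul_smul, ← Matrix.mul_assoc, h1, smul_add, add_assoc]
  have hXge : hsSq Ψ ≤ hsSq (Ψ + z • (H * Ψ)) := by
    have h1 : Uᴴ * (Ψ + z • (H * Ψ)) = diagonal (fun i => 1 + z * (e i : ℂ)) * (Uᴴ * Ψ) := by
      rw [Matrix.mul_add, Matrix.mul_smul, ← Matrix.mul_assoc Uᴴ H, hH, conjTranspose_mul_fnMat hU]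
      ext i j
      rw [Matrix.add_apply, Matrix.smul_apply, Matrix.mul_assoc, diagonal_mul, diagonal_mul]
      simp only [id, smul_eq_mul]
      ring
    have hUs : (Uᴴ)ᴴ * Uᴴ = 1 := by simpa using hU'
    rw [← hsSq_mul_of_isometry hUs Ψ, ← hsSq_mul_of_isometry hUs (Ψ + _), h1]
    unfold hsSq
    refine Finset.sum_le_sum fun i _ => Finset.sum_le_sum fun j _ => ?_
    rw [diagonal_mul, norm_mul, mul_pow]
    refine le_mul_of_one_le_left (sq_nonneg _) ?_
    have h2 : (1 : ℂ) + z * (e i : ℂ) = ⟨1, s / Δ * e i⟩ := by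
      rw [hz]
      apply Complex.ext <;> simp
    rw [h2, ← Complex.normSq_eq_norm_sq, Complex.normSq_mk]
    nlinarith [mul_self_nonneg (s / Δ * e i)]
  have hY : hsSq (z • (V * Ψ)) ≤ 1 / 4 * hsSq Ψ := by
    have h1 := hsSq_mul_le_of_row_col (R := Δ / 2) (by positivity) V
      (fun i => by simpa only [hVij] using hrow i) (fun j => by simpa only [hVij] using hcol j) Ψ
    rw [hsSq_smul, hz2]
    calc 1 / Δ ^ 2 * hsSq (V * Ψ) ≤ 1 / Δ ^ 2 * ((Δ / 2) ^ 2 * hsSq Ψ) := by gcongr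
      _ = 1 / 4 * hsSq Ψ := by field_simp; ring
  -- This gives ‖Ψ‖² ≤ 2‖WA + zWHA‖² + 2 · ¼‖Ψ‖², whence the constant 4.
  have hsum := hsSq_add_le (W * (A + z • (H * A))) (-(z • (V * Ψ)))
  rw [hsSq_neg] at hsum
  nth_rewrite 1 [hX] at hsum
  rw [add_neg_cancel_right] at hsum
  linarith

/-- The matrix `(1 + H² / Δ²)⁻ᵏ`. -/
def lowPass (U : Matrix n n ℂ) (e : n → ℝ) (Δ : ℝ) (k : ℕ) : Matrix n n ℂ :=
  fnMat U e fun x => ((1 + x ^ 2 / Δ ^ 2)⁻¹) ^ k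

theorem fnMat_mul_lowPass_succ (hU : Uᴴ * U = 1) (Δ : ℝ) (k : ℕ) :
    fnMat U e (fun x => 1 + x ^ 2 / Δ ^ 2) * lowPass U e Δ (k + 1) = lowPass U e Δ k := by
  rw [lowPass, lowPass, fnMat_mul hU]
  congr 1
  funext x
  have h : 0 < 1 + x ^ 2 / Δ ^ 2 := by positivity
  rw [pow_succ' _ k, mul_inv_cancel_left₀ h.ne']

/-- The factorization (1 - icH)(1 + icH) = 1 + c²H², which reduces the filter to two factors covered
by the Combes–Thomas estimate. -/
theorem factor_mul_factor {l : Type*} [Fintype l] (H B : Matrix l l ℂ) (c : ℝ) :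
    B + (Complex.I * (c : ℂ)) • (H * B)
      + (Complex.I * ((-c : ℝ) : ℂ)) • (H * (B + (Complex.I * (c : ℂ)) • (H * B)))
      = B + ((c ^ 2 : ℝ) : ℂ) • (H * H * B) := by
  have h1 : Complex.I * ((-c : ℝ) : ℂ) * (Complex.I * (c : ℂ)) = ((c ^ 2 : ℝ) : ℂ) := by
    push_cast
    linear_combination (-(c : ℂ) ^ 2) * Complex.I_sq
  have h2 : Complex.I * ((-c : ℝ) : ℂ) = -(Complex.I * (c : ℂ)) := by
    push_cast; ring
  rw [Matrix.mul_add, Matrix.mul_smul, smul_add, smul_smul, h1, h2, neg_smul, Matrix.mul_assoc]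
  abel

/-- One factor 4 for each of 1 ± iH/Δ. -/
theorem hsSq_weighted_lowPass_succ_le (hU : Uᴴ * U = 1) (hU' : U * Uᴴ = 1) {D : n → ℝ}
    (hD : ∀ i, 0 < D i) {Δ : ℝ} (hΔ : 0 < Δ)
    (hrow : ∀ i, ∑ j, ‖fnMat U e id i j‖ * |D i * (D j)⁻¹ - 1| ≤ Δ / 2)
    (hcol : ∀ j, ∑ i, ‖fnMat U e id i j‖ * |D i * (D j)⁻¹ - 1| ≤ Δ / 2)
    (k : ℕ) (A : Matrix n n ℂ) :
    hsSq (diagonal (fun i => (D i : ℂ)) * (lowPass U e Δ (k + 1) * A)) ≤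
      16 * hsSq (diagonal (fun i => (D i : ℂ)) * (lowPass U e Δ k * A)) := by
  set B := lowPass U e Δ (k + 1) * A with hB
  have h1 := hsSq_weighted_le_factor hU hU' hD hΔ hrow hcol (s := 1) (by norm_num) B
  have h2 := hsSq_weighted_le_factor hU hU' hD hΔ hrow hcol (s := -1) (by norm_num)
    (B + (Complex.I * (1 / Δ : ℝ)) • (fnMat U e id * B))
  have h3 : fnMat U e (fun x => 1 + x ^ 2 / Δ ^ 2)
      = 1 + (((1 / Δ) ^ 2 : ℝ) : ℂ) • (fnMat U e id * fnMat U e id) := by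
    rw [fnMat_mul hU, fnMat_smul, ← fnMat_one hU', fnMat_add]
    congr 1
    funext x
    simp only [id]
    ring
  rw [neg_div, factor_mul_factor] at h2
  have h4 : B + (((1 / Δ) ^ 2 : ℝ) : ℂ) • (fnMat U e id * fnMat U e id * B)
      = lowPass U e Δ k * A := by
    rw [← fnMat_mul_lowPass_succ hU, h3, Matrix.mul_assoc _ _ A, ← hB, Matrix.add_mul,
      Matrix.one_mul, Matrix.smul_mul]
  rw [h4] at h2
  linarith

/-- If `H` is gapped up to an error carried by a weight, then low energy filtering of a matrix that
is small in the weighted norm reduces its Hilbert–Schmidt norm exponentially. -/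
theorem hsSq_lowPass_le (hU : Uᴴ * U = 1) (hU' : U * Uᴴ = 1) {D : n → ℝ}
    (hD : ∀ i, 0 < D i) {Δ : ℝ} (hΔ : 0 < Δ)
    (hrow : ∀ i, ∑ j, ‖fnMat U e id i j‖ * |D i * (D j)⁻¹ - 1| ≤ Δ / 2)
    (hcol : ∀ j, ∑ i, ‖fnMat U e id i j‖ * |D i * (D j)⁻¹ - 1| ≤ Δ / 2)
    {G b : ℝ} (hG : 0 ≤ G)
    (hgap : ∀ A : Matrix n n ℂ, Δ ^ 2 * hsSq A ≤ hsSq (fnMat U e id * A)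
      + G * hsSq (diagonal (fun i => (D i : ℂ)) * A))
    {J : Matrix n n ℂ} (hJ : hsSq J ≤ b) (hDJ : hsSq (diagonal (fun i => (D i : ℂ)) * J) ≤ b)
    (k : ℕ) : hsSq (lowPass U e Δ k * J) ≤ (1 / 3) ^ k * b + G / Δ ^ 2 * 16 ^ k * b := by
  have h0 : lowPass U e Δ 0 = 1 := by
    simp only [lowPass, pow_zero, fnMat_one hU']
  have hb : 0 ≤ b := (hsSq_nonneg _).trans hJ
  have hw : ∀ k, hsSq (diagonal (fun i => (D i : ℂ)) * (lowPass U e Δ k * J)) ≤ 16 ^ k * b := by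
    intro k
    induction k with
    | zero => simpa [h0] using hDJ
    | succ k ih =>
      refine (hsSq_weighted_lowPass_succ_le hU hU' hD hΔ hrow hcol k J).trans ?_
      rw [pow_succ]
      linarith
  induction k with
  | zero =>
    simp only [h0, Matrix.one_mul, pow_zero]
    have : 0 ≤ G / Δ ^ 2 * 1 * b := by positivity
    linarith
  | succ k ih =>
    set B := lowPass U e Δ (k + 1) * J with hB
    have h1 : lowPass U e Δ k * J = fnMat U e (fun x => 1 + x ^ 2 / Δ ^ 2) * B := by
      rw [hB, ← Matrix.mul_assoc, fnMat_mul_lowPass_succ hU]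
    -- From (1 + y)² ≥ 1 + 2y with y = e²/Δ². The gap then bounds the second term below by 2‖B‖² up
    -- to the boundary error, so 3‖B‖² appears and each step gains 1/3.
    have h2 : hsSq B + 2 / Δ ^ 2 * hsSq (fnMat U e id * B) ≤ hsSq (lowPass U e Δ k * J) := by
      have h3 : hsSq B = hsSq (fnMat U e (fun _ => 1) * B) := by
        rw [fnMat_one hU', Matrix.one_mul]
      rw [h1, h3]
      simp only [hsSq_fnMat_mul hU hU', Finset.mul_sum, ← Finset.sum_add_distrib]
      refine Finset.sum_le_sum fun i _ => Finset.sum_le_sum fun j _ => ?_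
      have h4 : 2 / Δ ^ 2 * (id (e i) ^ 2 * ‖(Uᴴ * B) i j‖ ^ 2)
          = 2 * (e i ^ 2 / Δ ^ 2) * ‖(Uᴴ * B) i j‖ ^ 2 := by
        simp only [id]; ring
      rw [h4]
      nlinarith [mul_nonneg (sq_nonneg (e i ^ 2 / Δ ^ 2)) (sq_nonneg ‖(Uᴴ * B) i j‖)]
    have h3 : 2 * hsSq B ≤ 2 / Δ ^ 2 * hsSq (fnMat U e id * B)
        + 2 * (G / Δ ^ 2 * (16 ^ (k + 1) * b)) := by
      have h4 := (hgap B).trans (add_le_add le_rfl (mul_le_mul_of_nonneg_left (hw (k + 1)) hG))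
      have h5 : 2 / Δ ^ 2 * (Δ ^ 2 * hsSq B) = 2 * hsSq B := by field_simp
      rw [← h5]
      refine (mul_le_mul_of_nonneg_left h4 (by positivity)).trans_eq ?_
      ring
    have h6 : hsSq B ≤ 1 / 3 * ((1 / 3) ^ k * b + G / Δ ^ 2 * 16 ^ k * b)
        + 2 / 3 * (G / Δ ^ 2 * (16 ^ (k + 1) * b)) := by linarith
    -- The boundary terms close up because 1/3 + (2/3) · 16 = 11 ≤ 16.
    refine h6.trans ?_
    have h7 : 0 ≤ G / Δ ^ 2 * 16 ^ k * b := by positivity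
    rw [pow_succ (1 / 3 : ℝ), pow_succ (16 : ℝ)]
    rw [pow_succ (16 : ℝ)] at h6
    linarith

end Weighted

/-! ### Localization near the cut -/

section Cut

/-- Above, convexity of exp between 0 and s; below, e^t ≥ 1 + t. The linear factor κ lets the
conjugated perturbation be made as small as Δ/2. -/
theorem abs_exp_sub_one_le {κ s t : ℝ} (hκ0 : 0 ≤ κ) (hκ1 : κ ≤ 1)
    (ht : |t| ≤ κ * s) : |Real.exp t - 1| ≤ κ * Real.exp s := by
  rw [abs_le] at ht ⊢
  have h1 : Real.exp (κ * s) ≤ κ * Real.exp s + (1 - κ) := by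
    have h := convexOn_exp.2 (Set.mem_univ s) (Set.mem_univ 0) hκ0 (sub_nonneg.2 hκ1) (by ring)
    simpa using h
  have h2 : Real.exp t ≤ Real.exp (κ * s) := Real.exp_le_exp.2 ht.2
  have h3 := Real.add_one_le_exp t
  have h4 : κ * s ≤ κ * Real.exp s :=
    mul_le_mul_of_nonneg_left (by linarith [Real.add_one_le_exp s]) hκ0
  constructor <;> linarith

/-- The distance to the cut between the sites `m - 1` and `m`. -/
def cutDist (m : ℕ) (x : ℤ) : ℝ := |(x : ℝ) - (m - 1 / 2)|

theorem cutDist_sub_le (m : ℕ) (x y : ℤ) : cutDist m x - cutDist m y ≤ |(x : ℝ) - y| := by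
  have h := abs_sub_abs_le_abs_sub ((x : ℝ) - (m - 1 / 2)) ((y : ℝ) - (m - 1 / 2))
  rwa [sub_sub_sub_cancel_right] at h

/-- Centring the distance at the half-integer m - 1/2 makes L/2 valid at both ends for all three
admissible values of m. -/
theorem half_le_cutDist {L m : ℕ} (hm : 2 * m = L ∨ 2 * m + 1 = L ∨ 2 * m = L + 1) (x : ℤ)
    (hx : x < 0 ∨ (L : ℤ) ≤ x) : (L : ℝ) / 2 ≤ cutDist m x := by
  have h1 : (L : ℝ) ≤ 2 * m + 1 := by
    have : L ≤ 2 * m + 1 := by omega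
    exact_mod_cast this
  have h2 : 2 * (m : ℝ) ≤ L + 1 := by
    have : 2 * m ≤ L + 1 := by omega
    exact_mod_cast this
  rw [cutDist, le_abs]
  rcases hx with hx | hx
  · right
    have h3 : (x : ℝ) ≤ -1 := by
      have : x ≤ -1 := by omega
      exact_mod_cast this
    linarith
  · left
    have h3 : (L : ℝ) ≤ x := by exact_mod_cast hx
    linarith

/-- Sites on opposite sides of the cut are at least as far from each other as from the cut. -/
theorem cutDist_le_of_lt_of_le {m : ℕ} {x y : ℤ} (hx : x < m) (hy : (m : ℤ) ≤ y) :
    cutDist m x ≤ |(x : ℝ) - y| ∧ cutDist m y ≤ |(x : ℝ) - y| := by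
  have h1 : (x : ℝ) ≤ m - 1 := by
    have : x ≤ (m : ℤ) - 1 := by omega
    exact_mod_cast this
  have h2 : (m : ℝ) ≤ y := by exact_mod_cast hy
  rw [cutDist, cutDist, abs_of_nonpos (by linarith : (x : ℝ) - y ≤ 0),
    abs_of_nonpos (by linarith : (x : ℝ) - (m - 1 / 2) ≤ 0),
    abs_of_nonneg (by linarith : 0 ≤ (y : ℝ) - (m - 1 / 2))]
  constructor <;> linarith

variable {T : BulkSpace →L[ℂ] BulkSpace} {d K κ : ℝ} {L : ℕ}

/-- The exponential weight that grows away from the cut. -/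
def cutWeight (μ : ℝ) (m : ℕ) (v : Fin L × Fin 2) : ℝ := Real.exp (μ * cutDist m (site v).1)

theorem cutWeight_pos (μ : ℝ) (m : ℕ) (v : Fin L × Fin 2) : 0 < cutWeight μ m v := Real.exp_pos _

theorem norm_mul_cutWeight_ratio_le (hd : 0 < d) (hκ0 : 0 ≤ κ) (hκ1 : κ ≤ 1) (m : ℕ)
    (i j : Fin L × Fin 2) :
    ‖truncation L T i j‖ * |cutWeight (κ / d) m i * (cutWeight (κ / d) m j)⁻¹ - 1|
      ≤ κ * weightedEntry T d (site i) (site j) := by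
  have h1 : cutWeight (κ / d) m i * (cutWeight (κ / d) m j)⁻¹
      = Real.exp (κ / d * (cutDist m (site i).1 - cutDist m (site j).1)) := by
    rw [cutWeight, cutWeight, ← Real.exp_neg, ← Real.exp_add]
    ring_nf
  have h2 := cutDist_sub_le m (site i).1 (site j).1
  have h3 := cutDist_sub_le m (site j).1 (site i).1
  rw [abs_sub_comm] at h3
  have h4 : |κ / d * (cutDist m (site i).1 - cutDist m (site j).1)|
      ≤ κ * (|((site i).1 : ℝ) - (site j).1| / d) := by
    rw [abs_mul, abs_of_nonneg (by positivity : 0 ≤ κ / d)]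
    have h5 : |cutDist m (site i).1 - cutDist m (site j).1| ≤ |((site i).1 : ℝ) - (site j).1| :=
      abs_le.2 ⟨by linarith, h2⟩
    calc κ / d * |cutDist m (site i).1 - cutDist m (site j).1|
        ≤ κ / d * |((site i).1 : ℝ) - (site j).1| := by gcongr
      _ = _ := by ring
  have h5 := abs_exp_sub_one_le hκ0 hκ1 h4
  rw [h1]
  refine (mul_le_mul_of_nonneg_left h5 (norm_nonneg _)).trans_eq ?_
  rw [weightedEntry]
  have h6 : truncation L T i j = block T (site i).1 (site j).1 (site i).2 (site j).2 := rfl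
  rw [h6]
  ring

theorem sum_weightedEntry_site_le (hs : IsShortRange T d K) (i : Fin L × Fin 2) :
    ∑ j : Fin L × Fin 2, weightedEntry T d (site i) (site j) ≤ 2 * K := by
  classical
  have := sum_weightedEntry_le hs (site i) (Finset.univ.image (site (L := L)))
  rwa [Finset.sum_image site_injective.injOn] at this

/-- The commutator of the truncated operator with the step function is localized near the cut. -/
theorem hsSq_cutWeight_mul_commutator_le (hd : 0 < d) (hs : IsShortRange T d K)
    (hκ0 : 0 ≤ κ) (hκ : κ ≤ 1 / 2) {m : ℕ} {θ : Fin L → ℝ}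
    (hθ : ∀ x : Fin L, θ x = if (x : ℕ) < m then 1 else 0) :
    hsSq (diagonal (fun i => (cutWeight (κ / d) m i : ℂ)) *
      (mulOp θ * truncation L T - truncation L T * mulOp θ)) ≤ 2 * L * (4 * d * K) ^ 2 := by
  have hentry : ∀ i j : Fin L × Fin 2,
      ‖(diagonal (fun i => (cutWeight (κ / d) m i : ℂ)) *
        (mulOp θ * truncation L T - truncation L T * mulOp θ) : ChainMatrix L) i j‖
        ≤ 2 * d * weightedEntry T d (site i) (site j) := by
    intro i j
    have h6 : truncation L T i j = block T (site i).1 (site j).1 (site i).2 (site j).2 := rfl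
    have h1 : (diagonal (fun i => (cutWeight (κ / d) m i : ℂ)) *
        (mulOp θ * truncation L T - truncation L T * mulOp θ) : ChainMatrix L) i j
        = ((cutWeight (κ / d) m i * (θ i.1 - θ j.1) : ℝ) : ℂ) * truncation L T i j := by
      rw [diagonal_mul, Matrix.sub_apply, mulOp, diagonal_mul, mul_diagonal]
      push_cast
      ring
    have hw0 : 0 ≤ 2 * d * weightedEntry T d (site i) (site j) :=
      mul_nonneg (by positivity) (weightedEntry_nonneg _ _)
    by_cases hij : ((i.1 : ℕ) < m ↔ (j.1 : ℕ) < m)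
    · rw [h1, hθ, hθ]
      simp only [hij, sub_self, mul_zero, Complex.ofReal_zero, zero_mul, norm_zero]
      exact hw0
    · have hθ1 : |θ i.1 - θ j.1| = 1 := by
        rw [hθ, hθ]
        split_ifs with ha hb hb
        · exact absurd (iff_of_true ha hb) hij
        · norm_num
        · norm_num
        · exact absurd (iff_of_false ha hb) hij
      have hi : (site i).1 = ((i.1 : ℕ) : ℤ) := rfl
      have hj : (site j).1 = ((j.1 : ℕ) : ℤ) := rfl
      -- An entry of the commutator survives only if it jumps over the cut. The weight at i is then
      -- dominated by the hopping distance, which the short-range weight controls.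
      have hdist : cutDist m (site i).1 ≤ |((site i).1 : ℝ) - (site j).1| := by
        rcases lt_or_ge (i.1 : ℕ) m with ha | ha
        · have hb : m ≤ (j.1 : ℕ) := by
            by_contra hb
            exact hij (iff_of_true ha (not_le.1 hb))
          exact (cutDist_le_of_lt_of_le (by omega) (by omega)).1
        · have hb : (j.1 : ℕ) < m := by
            by_contra hb
            exact hij (iff_of_false (not_lt.2 ha) hb)
          rw [abs_sub_comm]
          exact (cutDist_le_of_lt_of_le (by omega) (by omega)).2
      have hne : (site i).1 ≠ (site j).1 := by
        intro h
        rw [hi, hj, Nat.cast_inj] at h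
        exact hij (by rw [h])
      have hs1 : 1 / d ≤ |((site i).1 : ℝ) - (site j).1| / d := by
        have h2 : 1 ≤ |(site i).1 - (site j).1| := Int.one_le_abs (sub_ne_zero.2 hne)
        have h3 : (1 : ℝ) ≤ |((site i).1 : ℝ) - (site j).1| := by exact_mod_cast h2
        gcongr
      have hcw : cutWeight (κ / d) m i
          ≤ 2 * d * Real.exp (|((site i).1 : ℝ) - (site j).1| / d) := by
        refine le_trans (Real.exp_le_exp.2 ?_) (exp_mul_le_two_mul_exp hd hκ hs1)
        calc κ / d * cutDist m (site i).1 ≤ κ / d * |((site i).1 : ℝ) - (site j).1| := by gcongr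
          _ = _ := by ring
      rw [h1, norm_mul, Complex.norm_real, Real.norm_eq_abs, abs_mul, hθ1, mul_one,
        abs_of_pos (cutWeight_pos _ _ _), weightedEntry, h6]
      calc _ ≤ 2 * d * Real.exp (|((site i).1 : ℝ) - (site j).1| / d) *
            ‖block T (site i).1 (site j).1 (site i).2 (site j).2‖ := by gcongr
        _ = _ := by ring
  have hrow : ∀ i : Fin L × Fin 2, ∑ j, ‖(diagonal (fun i => (cutWeight (κ / d) m i : ℂ)) *
        (mulOp θ * truncation L T - truncation L T * mulOp θ) : ChainMatrix L) i j‖ ^ 2 ≤ (4 * d * K) ^ 2 := by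
    intro i
    calc _ ≤ ∑ j, (2 * d * weightedEntry T d (site i) (site j)) ^ 2 := by
          gcongr with j
          exact hentry i j
      _ ≤ (∑ j : Fin L × Fin 2, 2 * d * weightedEntry T d (site i) (site j)) ^ 2 :=
          Finset.sum_sq_le_sq_sum_of_nonneg fun j _ =>
            mul_nonneg (by positivity) (weightedEntry_nonneg _ _)
      _ ≤ (4 * d * K) ^ 2 := by
          have h0 : 0 ≤ ∑ j : Fin L × Fin 2, 2 * d * weightedEntry T d (site i) (site j) :=
            Finset.sum_nonneg fun j _ => mul_nonneg (by positivity) (weightedEntry_nonneg _ _)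
          have h1 := sum_weightedEntry_site_le hs i
          have h2 : ∑ j : Fin L × Fin 2, 2 * d * weightedEntry T d (site i) (site j) ≤ 4 * d * K := by
            rw [← Finset.mul_sum]
            nlinarith
          gcongr
  calc _ ≤ ∑ _i : Fin L × Fin 2, (4 * d * K) ^ 2 := Finset.sum_le_sum fun i _ => hrow i
    _ = 2 * L * (4 * d * K) ^ 2 := by
        rw [Finset.sum_const, Finset.card_univ, Fintype.card_prod, Fintype.card_fin,
          Fintype.card_fin, nsmul_eq_mul]
        push_cast
        ring

theorem hsSq_le_cutWeight_mul {μ : ℝ} (hμ : 0 ≤ μ) (m : ℕ) (A : ChainMatrix L) :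
    hsSq A ≤ hsSq (diagonal (fun i => (cutWeight μ m i : ℂ)) * A) := by
  unfold hsSq
  refine Finset.sum_le_sum fun i _ => Finset.sum_le_sum fun j _ => ?_
  have h1 : 1 ≤ cutWeight μ m i := Real.one_le_exp (mul_nonneg hμ (abs_nonneg _))
  rw [diagonal_mul, norm_mul, Complex.norm_real, Real.norm_eq_abs, abs_of_pos (cutWeight_pos _ _ _)]
  gcongr
  exact le_mul_of_one_le_left (norm_nonneg _) h1

/-- The matrix form of the gap estimate. -/
theorem gap_le_hsSq_mul_add_boundary (hT : IsSelfAdjoint T) {Δ : ℝ} (hΔ : 0 < Δ)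
    (hgap : HasSpectralGap T Δ) (hd : 0 < d) (hK : 0 < K) (hs : IsShortRange T d K)
    (hκ0 : 0 ≤ κ) (hκ : κ ≤ 1 / 2) {m : ℕ} (hm : 2 * m = L ∨ 2 * m + 1 = L ∨ 2 * m = L + 1)
    (A : ChainMatrix L) :
    Δ ^ 2 * hsSq A ≤ hsSq (truncation L T * A) + (4 * d * K) ^ 2 * Real.exp (-(κ * L / d)) *
      hsSq (diagonal (fun i => (cutWeight (κ / d) m i : ℂ)) * A) := by
  have h := fun j => gap_le_norm_mulVec_add_boundary hT hΔ hgap hd hK hs hκ0 hκ (cutDist_sub_le m)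
    (half_le_cutDist hm) fun i => A i j
  have h2 := Finset.sum_le_sum fun j (_ : j ∈ Finset.univ) => h j
  simp only [Finset.sum_add_distrib, ← Finset.mul_sum] at h2
  rw [← hsSq_conjTranspose A, ← hsSq_conjTranspose (truncation L T * A),
    ← hsSq_conjTranspose (diagonal _ * A)]
  have h3 : 2 * κ * ((L : ℝ) / 2) / d = κ * L / d := by ring
  rw [h3] at h2
  have h4 : ∀ i j, (Real.exp (κ / d * cutDist m (site i).1) * ‖A i j‖)
      = ‖(diagonal (fun i => (cutWeight (κ / d) m i : ℂ)) * A : ChainMatrix L) i j‖ := by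
    intro i j
    rw [diagonal_mul, norm_mul, Complex.norm_real, Real.norm_eq_abs,
      abs_of_pos (cutWeight_pos _ _ _)]
    rfl
  simp only [h4] at h2
  simp only [hsSq, conjTranspose_apply, norm_star]
  exact h2

end Cut

/-! ### The index theorem -/

section Main

/-- Split at |x| = Δ/2. Above, sech² decays exponentially; below, (1 + x²/Δ²)⁻¹ ≥ 4/5, and (25/16)ᵏ
compensates for its 2k-th power. The factor `1 ^ 2` matches the shape of `hsSq_fnMat_mul_le`. -/
theorem inv_cosh_sq_le_add {Δ δ : ℝ} (hΔ : 0 < Δ) (hδ : 0 < δ) (k : ℕ) (x : ℝ) :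
    (Real.cosh (x / δ))⁻¹ ^ 2 ≤ 4 * Real.exp (-(Δ / δ)) * 1 ^ 2
      + (25 / 16) ^ k * ((1 + x ^ 2 / Δ ^ 2)⁻¹ ^ k) ^ 2 := by
  rcases le_or_gt (Δ / 2) |x| with h | h
  · have h1 := inv_cosh_sq_le (x / δ)
    have h2 : Δ / δ ≤ 2 * |x / δ| := by
      rw [abs_div, abs_of_pos hδ, ← mul_div_assoc]
      gcongr
      linarith
    have h3 : Real.exp (-(2 * |x / δ|)) ≤ Real.exp (-(Δ / δ)) := Real.exp_le_exp.2 (by linarith)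
    have h4 : 0 ≤ (25 / 16 : ℝ) ^ k * ((1 + x ^ 2 / Δ ^ 2)⁻¹ ^ k) ^ 2 := by positivity
    linarith
  · have h1 : (Real.cosh (x / δ))⁻¹ ^ 2 ≤ 1 :=
      pow_le_one₀ (inv_nonneg.2 (Real.cosh_pos _).le) (inv_cosh_le_one _)
    have h2 : 4 / 5 ≤ (1 + x ^ 2 / Δ ^ 2)⁻¹ := by
      have h3 : x ^ 2 / Δ ^ 2 ≤ 1 / 4 := by
        rw [div_le_iff₀ (by positivity), ← sq_abs]
        nlinarith [abs_nonneg x]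
      rw [le_inv_comm₀ (by norm_num) (by positivity)]
      linarith
    have h4 : 1 ≤ (25 / 16 : ℝ) ^ k * ((1 + x ^ 2 / Δ ^ 2)⁻¹ ^ k) ^ 2 := by
      rw [← pow_mul, mul_comm k 2, pow_mul, ← mul_pow]
      refine one_le_pow₀ ?_
      nlinarith
    have h5 := Real.exp_pos (-(Δ / δ))
    linarith

/-- The loss 25/16 beats the gain 1/3 only partly: 25/48 ≤ e^{-1/2}, because (48/25)² > e. This is
why k must be at least 2E. -/
theorem pow_le_exp_neg {E : ℝ} {k : ℕ} (hk : 2 * E ≤ k) :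
    (25 / 16 : ℝ) ^ k * (1 / 3) ^ k ≤ Real.exp (-E) := by
  have h1 : (25 / 48 : ℝ) ≤ Real.exp (-(1 / 2)) := by
    rw [Real.exp_neg, le_inv_comm₀ (by norm_num) (Real.exp_pos _)]
    have h2 : Real.exp (1 / 2) ^ 2 = Real.exp 1 := by
      rw [← Real.exp_nat_mul]; norm_num
    have h3 := Real.exp_one_lt_d9
    refine (abs_le_of_sq_le_sq' ?_ (by norm_num)).2
    rw [h2]
    norm_num at h3 ⊢
    linarith
  rw [← mul_pow]
  calc (25 / 16 * (1 / 3) : ℝ) ^ k ≤ Real.exp (-(1 / 2)) ^ k := by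
        gcongr
        norm_num at h1 ⊢
        linarith
    _ = Real.exp (-(k / 2)) := by rw [← Real.exp_nat_mul]; congr 1; ring
    _ ≤ Real.exp (-E) := Real.exp_le_exp.2 (by linarith)

/-- Since 25 ≤ e⁴, the exponent is at most 8E + 4 - 32E², which is below -E once E ≥ 1. -/
theorem pow_mul_exp_le_exp_neg {E : ℝ} (hE : 1 ≤ E) {k : ℕ} (hk : (k : ℝ) ≤ 2 * E + 1) :
    (25 / 16 : ℝ) ^ k * (16 ^ k * Real.exp (-(32 * E ^ 2))) ≤ Real.exp (-E) := by
  have h1 : (25 : ℝ) ≤ Real.exp 4 := by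
    have h2 : Real.exp 4 = Real.exp 1 ^ 4 := by rw [← Real.exp_nat_mul]; norm_num
    have h3 : (2.7 : ℝ) ≤ Real.exp 1 := by have := Real.exp_one_gt_d9; norm_num at this ⊢; linarith
    rw [h2]
    calc (25 : ℝ) ≤ 2.7 ^ 4 := by norm_num
      _ ≤ Real.exp 1 ^ 4 := by gcongr
  rw [← mul_assoc, ← mul_pow]
  calc (25 / 16 * 16 : ℝ) ^ k * Real.exp (-(32 * E ^ 2))
      ≤ Real.exp 4 ^ k * Real.exp (-(32 * E ^ 2)) := by
        gcongr
        norm_num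
        exact h1
    _ = Real.exp (k * 4 - 32 * E ^ 2) := by rw [← Real.exp_nat_mul, ← Real.exp_add]; rfl
    _ ≤ Real.exp (-E) := Real.exp_le_exp.2 (by nlinarith)

theorem mulOp_conjTranspose {L : ℕ} (θ : Fin L → ℝ) : (mulOp θ)ᴴ = mulOp θ := by
  rw [mulOp, diagonal_conjTranspose]
  congr 1
  ext i
  simp

theorem mulOp_mul_self {L m : ℕ} {θ : Fin L → ℝ}
    (hθ : ∀ x : Fin L, θ x = if (x : ℕ) < m then 1 else 0) : mulOp θ * mulOp θ = mulOp θ := by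
  rw [mulOp, diagonal_mul_diagonal]
  congr 1
  ext i
  rw [hθ]
  split_ifs <;> simp

theorem chiralOp_conjTranspose (L : ℕ) : (chiralOp L)ᴴ = chiralOp L := by
  rw [chiralOp, diagonal_conjTranspose]
  congr 1
  ext i
  simp only [Pi.star_apply]
  split_ifs <;> simp

theorem chiralOp_mul_self (L : ℕ) : chiralOp L * chiralOp L = 1 := by
  rw [chiralOp, diagonal_mul_diagonal, ← diagonal_one]
  congr 1
  ext i
  split_ifs <;> simp

theorem mulOp_mul_chiralOp {L : ℕ} (θ : Fin L → ℝ) :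
    mulOp θ * chiralOp L = chiralOp L * mulOp θ := by
  rw [mulOp, chiralOp, diagonal_mul_diagonal, diagonal_mul_diagonal]
  simp only [mul_comm]

theorem trace_chiralOp_mul_mulOp {L : ℕ} (θ : Fin L → ℝ) :
    (chiralOp L * mulOp θ).trace = 0 := by
  rw [chiralOp, mulOp, diagonal_mul_diagonal, trace_diagonal, Fintype.sum_prod_type]
  simp [Fin.sum_univ_two]

theorem trace_chiralOp (L : ℕ) : (chiralOp L).trace = 0 := by
  rw [chiralOp, trace_diagonal, Fintype.sum_prod_type]
  simp [Fin.sum_univ_two]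

variable {L : ℕ} {H : ChainMatrix L} {U : ChainMatrix L} {e : Fin L × Fin 2 → ℝ}

/-- The bulk and the edge index of a finite chain coincide. -/
theorem bulkIndex_eq_edgeIndex (hU : Uᴴ * U = 1) (hU' : U * Uᴴ = 1) (hH : H = fnMat U e id)
    (hcfc : ∀ f : ℝ → ℝ, cfc f H = fnMat U e f) (hchi : IsChiral H) (θ : Fin L → ℝ) (δ : ℝ) :
    bulkIndex H θ δ = edgeIndex H θ δ := by
  have hSC : regSign H δ * chiralOp L = -(chiralOp L * regSign H δ) := by
    rw [IsChiral, hH] at hchi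
    rw [regSign, hcfc]
    have := fnMat_commute_of_even hU hU' hchi (f := fun x => Real.tanh (x / δ)) (s := -1)
      (fun x => by simp [neg_div, Real.tanh_neg])
    rwa [Complex.ofReal_neg, Complex.ofReal_one, neg_one_smul] at this
  rw [bulkIndex, edgeIndex]
  generalize regSign H δ = S at hSC
  have h1 : (chiralOp L * S * (mulOp θ * S)).trace = -(chiralOp L * (S * (S * mulOp θ))).trace := by
    rw [← Matrix.mul_assoc, trace_mul_comm, ← Matrix.mul_assoc, ← Matrix.mul_assoc, hSC,
      Matrix.neg_mul, Matrix.neg_mul, trace_neg]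
    simp only [Matrix.mul_assoc]
  have h2 : (chiralOp L * mulOp θ * (S * S)).trace = (chiralOp L * (S * (S * mulOp θ))).trace := by
    rw [← mulOp_mul_chiralOp, Matrix.mul_assoc, trace_mul_comm]
    simp only [Matrix.mul_assoc]
  rw [Matrix.mul_sub, trace_sub, h1, Matrix.mul_sub, trace_sub, Matrix.mul_one,
    trace_chiralOp_mul_mulOp, pow_two, h2]
  simp only [Matrix.mul_assoc]
  ring

theorem edgeIndex_eq_trace (hU : Uᴴ * U = 1) (hU' : U * Uᴴ = 1)
    (hcfc : ∀ f : ℝ → ℝ, cfc f H = fnMat U e f) (θ : Fin L → ℝ) (δ : ℝ) :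
    edgeIndex H θ δ =
      (chiralOp L * mulOp θ * fnMat U e fun x => (Real.cosh (x / δ))⁻¹ ^ 2).trace := by
  have h : 1 - regSign H δ ^ 2 = fnMat U e fun x => (Real.cosh (x / δ))⁻¹ ^ 2 := by
    rw [regSign, hcfc, pow_two, fnMat_mul hU, sub_eq_iff_eq_add, fnMat_add, ← fnMat_one hU']
    congr 1
    funext x
    rw [← tanh_sq_add_inv_cosh_sq (x / δ)]
    ring
  rw [edgeIndex, h]

/-- The weight of the low energy states at the cut. -/
theorem hsSq_inv_cosh_mul_commutator_le {T : BulkSpace →L[ℂ] BulkSpace} (hT : IsSelfAdjoint T)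
    (hU : Uᴴ * U = 1) (hU' : U * Uᴴ = 1) (hH : truncation L T = fnMat U e id)
    {d K Δ : ℝ} (hd : 0 < d) (hK : 0 < K) (hΔ : 0 < Δ) (hs : IsShortRange T d K)
    (hgap : HasSpectralGap T Δ) {m : ℕ} (hm : 2 * m = L ∨ 2 * m + 1 = L ∨ 2 * m = L + 1)
    {θ : Fin L → ℝ} (hθ : ∀ x : Fin L, θ x = if (x : ℕ) < m then 1 else 0)
    {δ : ℝ} (hδ : 0 < δ) (k : ℕ) :
    hsSq (fnMat U e (fun x => (Real.cosh (x / δ))⁻¹) *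
        (mulOp θ * fnMat U e id - fnMat U e id * mulOp θ)) ≤
      2 * L * (4 * d * K) ^ 2 * (4 * Real.exp (-(Δ / δ)) + (25 / 16) ^ k * (1 / 3) ^ k
        + (4 * d * K) ^ 2 / Δ ^ 2 *
          ((25 / 16) ^ k * (16 ^ k * Real.exp (-(L * Δ / (4 * d * K)))))) := by
  -- Chosen so that κ · 2K = Δ/2, the perturbation allowed by Combes–Thomas. The bound Δ ≤ 2K makes
  -- κ ≤ 1/2.
  set κ := Δ / (4 * K) with hκ
  have hκ0 : 0 ≤ κ := by positivity
  have hκ1 : κ ≤ 1 / 2 := by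
    rw [hκ, div_le_iff₀ (by positivity)]
    linarith [gap_le_two_mul hT hΔ hgap hd hK hs]
  set J := mulOp θ * fnMat U e id - fnMat U e id * mulOp θ with hJ
  have hDJ : hsSq (diagonal (fun i => (cutWeight (κ / d) m i : ℂ)) * J)
      ≤ 2 * L * (4 * d * K) ^ 2 := by
    rw [hJ, ← hH]
    exact hsSq_cutWeight_mul_commutator_le hd hs hκ0 hκ1 hθ
  have hJb := (hsSq_le_cutWeight_mul (by positivity) m J).trans hDJ
  have hκK : κ * (2 * K) = Δ / 2 := by rw [hκ]; field_simp; norm_num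
  have hrow : ∀ i, ∑ j, ‖fnMat U e id i j‖ *
      |cutWeight (κ / d) m i * (cutWeight (κ / d) m j)⁻¹ - 1| ≤ Δ / 2 := by
    intro i
    rw [← hH, ← hκK]
    refine (Finset.sum_le_sum fun j _ =>
      norm_mul_cutWeight_ratio_le hd hκ0 (by linarith) m i j).trans ?_
    rw [← Finset.mul_sum]
    exact mul_le_mul_of_nonneg_left (sum_weightedEntry_site_le hs i) hκ0
  have hcol : ∀ j, ∑ i, ‖fnMat U e id i j‖ *
      |cutWeight (κ / d) m i * (cutWeight (κ / d) m j)⁻¹ - 1| ≤ Δ / 2 := by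
    intro j
    rw [← hH, ← hκK]
    refine (Finset.sum_le_sum fun i _ =>
      norm_mul_cutWeight_ratio_le hd hκ0 (by linarith) m i j).trans ?_
    simp only [fun i => weightedEntry_comm (d := d) hT (site i) (site j)]
    rw [← Finset.mul_sum]
    exact mul_le_mul_of_nonneg_left (sum_weightedEntry_site_le hs j) hκ0
  have hlow := hsSq_lowPass_le hU hU' (fun i => cutWeight_pos (κ / d) m i) hΔ hrow hcol
    (G := (4 * d * K) ^ 2 * Real.exp (-(κ * L / d))) (by positivity)
    (fun A => by
      rw [← hH]
      exact gap_le_hsSq_mul_add_boundary hT hΔ hgap hd hK hs hκ0 hκ1 hm A) hJb hDJ k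
  have hsplit := hsSq_fnMat_mul_le (e := e) hU hU' (inv_cosh_sq_le_add hΔ hδ k) J
  rw [fnMat_one hU', Matrix.one_mul] at hsplit
  have hexp : κ * L / d = L * Δ / (4 * d * K) := by
    rw [hκ]; field_simp
  rw [hexp] at hlow
  refine hsplit.trans ?_
  calc _ ≤ 4 * Real.exp (-(Δ / δ)) * (2 * L * (4 * d * K) ^ 2) + (25 / 16) ^ k *
        ((1 / 3) ^ k * (2 * L * (4 * d * K) ^ 2) + (4 * d * K) ^ 2 *
          Real.exp (-(L * Δ / (4 * d * K))) / Δ ^ 2 * 16 ^ k * (2 * L * (4 * d * K) ^ 2)) := by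
        refine add_le_add (mul_le_mul_of_nonneg_left hJb (by positivity))
          (mul_le_mul_of_nonneg_left hlow (by positivity))
    _ = _ := by ring

/-- Both indices of a gapped short-range chain are exponentially close to an integer. -/
theorem exists_int_near_indices (hL : 1 ≤ L) (hH : H.IsHermitian) (hchi : IsChiral H)
    {T : BulkSpace →L[ℂ] BulkSpace} (hT : IsSelfAdjoint T) (hHT : H = truncation L T)
    {d K Δ : ℝ} (hd : 0 < d) (hK : 0 < K) (hΔ : 0 < Δ) (hs : IsShortRange T d K)
    (hgap : HasSpectralGap T Δ) {θ : Fin L → ℝ} (hθ : IsMiddleStep θ) {δ : ℝ}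
    (hδ : δ = Real.sqrt (128 * Δ * d * K / L)) :
    ∃ n : ℤ,
      ‖bulkIndex H θ δ - (n : ℂ)‖ ≤ (3 * (L : ℝ) + 2 * (L : ℝ) ^ 3 + (L : ℝ) ^ 5) *
          Real.exp (-Real.sqrt (L * Δ / (128 * d * K))) ∧
      ‖edgeIndex H θ δ - (n : ℂ)‖ ≤ (3 * (L : ℝ) + 2 * (L : ℝ) ^ 3 + (L : ℝ) ^ 5) *
          Real.exp (-Real.sqrt (L * Δ / (128 * d * K))) := by
  obtain ⟨m, hm, hθm⟩ := hθ
  obtain ⟨U, e, hU, hU', hHU, hcfc⟩ := exists_diagonalization hH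
  have hL0 : (1 : ℝ) ≤ L := by exact_mod_cast hL
  set E := Real.sqrt (L * Δ / (128 * d * K)) with hE
  have hE0 : 0 < E := Real.sqrt_pos.2 (by positivity)
  have hE2 : E ^ 2 = L * Δ / (128 * d * K) := Real.sq_sqrt (by positivity)
  have hδ0 : 0 < δ := by rw [hδ]; exact Real.sqrt_pos.2 (by positivity)
  have hδ2 : δ ^ 2 = 128 * Δ * d * K / L := by rw [hδ]; exact Real.sq_sqrt (by positivity)
  have hEδ : E * δ = Δ := by
    have h : (E * δ) ^ 2 = Δ ^ 2 := by
      rw [mul_pow, hE2, hδ2]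
      field_simp
    exact (pow_left_inj₀ (by positivity) hΔ.le two_ne_zero).1 h
  have hEdiv : Δ / δ = E := by rw [← hEδ]; field_simp
  have hchi' := hchi
  rw [IsChiral, hHU] at hchi'
  obtain ⟨n, hn1, hn2⟩ := exists_int_near_trace_inv_cosh_sq (L := L)
    (by simp [mul_comm]) hU hU' (chiralOp_conjTranspose L) (chiralOp_mul_self L)
    (mulOp_conjTranspose θ) (mulOp_mul_self hθm) (mulOp_mul_chiralOp θ)
    (trace_chiralOp_mul_mulOp θ) (trace_chiralOp L) hchi' hδ0
  rw [← edgeIndex_eq_trace hU hU' hcfc] at hn1 hn2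
  have hL3 : 0 ≤ (L : ℝ) ^ 3 := by positivity
  have hL5 : 0 ≤ (L : ℝ) ^ 5 := by positivity
  suffices hedge : ‖edgeIndex H θ δ - (n : ℂ)‖
      ≤ (3 * (L : ℝ) + 2 * (L : ℝ) ^ 3 + (L : ℝ) ^ 5) * Real.exp (-E) by
    refine ⟨n, ?_, hedge⟩
    rwa [bulkIndex_eq_edgeIndex hU hU' hHU hcfc hchi]
  have hx := Real.exp_pos (-E)
  -- For E < 1 the trivial bound L suffices, since 1 ≤ 3e^{-E}; this is the term 3L of the
  -- polynomial.
  rcases lt_or_ge E 1 with hE1 | hE1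
  · have h1 : 1 ≤ 3 * Real.exp (-E) := by
      have h2 : Real.exp (-1) ≤ Real.exp (-E) := Real.exp_le_exp.2 (by linarith)
      have h3 : 1 ≤ 3 * Real.exp (-1) := by
        rw [Real.exp_neg, ← div_eq_mul_inv, one_le_div (Real.exp_pos _)]
        have := Real.exp_one_lt_d9
        norm_num at this
        linarith
      linarith
    have h4 : 0 ≤ (2 * (L : ℝ) ^ 3 + (L : ℝ) ^ 5) * Real.exp (-E) := by positivity
    refine hn2.trans ?_
    nlinarith
  -- Large enough for (25/48)ᵏ ≤ e^{-E}, small enough for 25ᵏ to be absorbed by e^{-32E²}.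
  · set k := ⌈2 * E⌉₊ with hk
    have hk1 : 2 * E ≤ k := Nat.le_ceil _
    have hk2 : (k : ℝ) ≤ 2 * E + 1 := (Nat.ceil_lt_add_one (by positivity)).le
    have hlow := hsSq_inv_cosh_mul_commutator_le hT hU hU' (hHT.symm.trans hHU) hd hK hΔ hs hgap hm
      hθm hδ0 k
    have hexp : L * Δ / (4 * d * K) = 32 * E ^ 2 := by
      rw [hE2]; field_simp; norm_num
    rw [hEdiv, hexp] at hlow
    -- Expressing dK through δ and L cancels the prefactor 1/δ², leaving only powers of L.
    have hdK : 128 * (d * K) = δ * L / E := by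
      have h1 : 128 * (d * K) * Δ = δ ^ 2 * L := by rw [hδ2]; field_simp
      rw [eq_div_iff hE0.ne']
      have h2 : 128 * (d * K) * E * δ = δ * L * δ := by
        rw [mul_assoc _ E, hEδ, h1]; ring
      exact mul_right_cancel₀ hδ0.ne' h2
    have hdK1 : 4 * d * K ≤ δ * L / 32 := by
      have h1 : δ * L / E ≤ δ * L := div_le_self (by positivity) hE1
      linarith
    have hdK2 : (4 * d * K) ^ 2 / Δ ^ 2 ≤ (L : ℝ) ^ 2 := by
      rw [← div_pow]
      have h1 : δ ≤ Δ := by rw [← hEδ]; exact le_mul_of_one_le_left hδ0.le hE1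
      have h2 : 4 * d * K / Δ ≤ L := by
        rw [div_le_iff₀ hΔ]
        nlinarith
      gcongr
    have hb : 2 * L * (4 * d * K) ^ 2 ≤ δ ^ 2 * ((L : ℝ) ^ 3 / 512) := by
      calc 2 * L * (4 * d * K) ^ 2 ≤ 2 * L * (δ * L / 32) ^ 2 := by gcongr
        _ = δ ^ 2 * ((L : ℝ) ^ 3 / 512) := by ring
    refine hn1.trans ?_
    calc 128 / δ ^ 2 * _ ≤ 128 / δ ^ 2 * (δ ^ 2 * ((L : ℝ) ^ 3 / 512) *
          (4 * Real.exp (-E) + Real.exp (-E) + (L : ℝ) ^ 2 * Real.exp (-E))) := by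
          refine mul_le_mul_of_nonneg_left (hlow.trans ?_) (by positivity)
          have h1 := pow_le_exp_neg hk1
          have h2 := pow_mul_exp_le_exp_neg hE1 hk2
          gcongr
      _ = 5 / 4 * (L : ℝ) ^ 3 * Real.exp (-E) + 1 / 4 * (L : ℝ) ^ 5 * Real.exp (-E) := by
          field_simp
          ring
      _ ≤ _ := by
          have h1 : 0 ≤ (L : ℝ) * Real.exp (-E) := by positivity
          have h2 := mul_nonneg hL3 hx.le
          have h3 := mul_nonneg hL5 hx.le
          nlinarith

end Main

end ChiralChain

end

theorem theorem1 :
    ∃ P : MvPolynomial (Fin 3) ℝ,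
      ∀ (L : ℕ) (_ : 1 ≤ L)
        (H : ChiralChain.ChainMatrix L) (_ : H.IsHermitian) (_ : ChiralChain.IsChiral H)
        (Hbulk : ChiralChain.BulkSpace →L[ℂ] ChiralChain.BulkSpace) (_ : IsSelfAdjoint Hbulk)
        (_ : H = ChiralChain.truncation L Hbulk)
        (d K Δ : ℝ) (_ : 0 < d) (_ : 0 < K) (_ : 0 < Δ)
        (_ : ChiralChain.IsShortRange Hbulk d K) (_ : ChiralChain.HasSpectralGap Hbulk Δ)
        (θ : Fin L → ℝ) (_ : ChiralChain.IsMiddleStep θ)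
        (δ : ℝ) (_ : δ = Real.sqrt (128 * Δ * d * K / L)),
        ∃ n : ℤ,
          ‖ChiralChain.bulkIndex H θ δ - (n : ℂ)‖ ≤
              MvPolynomial.eval ![K, d, (L : ℝ)] P * Real.exp (-Real.sqrt (L * Δ / (128 * d * K))) ∧
          ‖ChiralChain.edgeIndex H θ δ - (n : ℂ)‖ ≤
              MvPolynomial.eval ![K, d, (L : ℝ)] P * Real.exp (-Real.sqrt (L * Δ / (128 * d * K))) := by
  -- The variable `X 2` is evaluated at L. A polynomial in L alone is enough, since dK has been
  -- eliminated in favour of δ, Δ and L.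
  refine ⟨3 * MvPolynomial.X 2 + 2 * MvPolynomial.X 2 ^ 3 + MvPolynomial.X 2 ^ 5, ?_⟩
  intro L hL H hH hchi T hT hHT d K Δ hd hK hΔ hs hgap θ hθ δ hδ
  have hP : MvPolynomial.eval ![K, d, (L : ℝ)]
      (3 * MvPolynomial.X 2 + 2 * MvPolynomial.X 2 ^ 3 + MvPolynomial.X 2 ^ 5)
      = 3 * (L : ℝ) + 2 * (L : ℝ) ^ 3 + (L : ℝ) ^ 5 := by
    simp
  rw [hP]
  exact ChiralChain.exists_int_near_indices hL hH hchi hT hHT hd hK hΔ hs hgap hθ hδ
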